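/- Let $q>1$ and let $\chi$ be a primitive Dirichlet character modulo $q$. Let $\kappa=0$ if $\chi(-1)=1$ and $\kappa=1$ if $\chi(-1)=-1$, and let $$\xi(s,\chi)=\left(\frac{q}{\pi}\right)^{(s+\kappa)/2}\Gamma\left(\frac{s+\kappa}{2}\right)L(s,\chi)$$ (analytically continued; an entire function). Put $$\varphi(y,\chi)=2\sum_{n=1}^{\infty}n^{\kappa}\chi(n)\exp\left(-\frac{n^{2}\pi}{q}e^{2y}+\left(\kappa+\tfrac12\right)y\right),\qquad a_n(\chi)=\frac1{n!}\int_{-\infty}^{\infty}y^n\varphi(y,\chi)\,dy ,$$ so that $\xi(\frac12+is,\chi)=\sum_{n\ge 0}i^na_n(\chi)s^n$. Let $\mu\ge 0$ be the least integer with $a_\mu(\chi)\ne0$, let $$f(s,\chi)=s^{-2\mu}\,\xi\left(\tfrac12+is,\chi\right)\xi\left(\tfrac12+is,\overline{\chi}\right)$$ (with the removable singularity at $s=0$ removed), and for $n\ge0$ let $$b_n(\chi)=(-1)^{\mu}\sum_{j=0}^{2n}a_{j+\mu}(\chi)\,a_{2n-j+\mu}(\overline\chi).$$ Then $b_0(\chi)\neq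 0$ and $f(s,\chi)=\sum_{n\ge0}(-1)^nb_n(\chi)s^{2n}$ for all $s\in\mathbb{C}$. For $k\ge0$ let $$m_k(\chi)=-\frac{1}{2\,(2k+3)!}\left(\frac{f'(s,\chi)}{f(s,\chi)}\right)^{(2k+3)}\bigg|_{s=0},$$ and write $b_n,m_n$ for $b_n(\chi),m_n(\chi)$. 1. For every $n\ge0$, $m_n=(-1)^n\det M_n$, where $M_n=(M_{ij})_{0\le i,j\le n}$ is the matrix with $M_{ij}=b_{i-j}/b_0$ for $j<n$, $j\le i$; $M_{ij}=0$ for $i<j<n$; and last column $M_{in}=\frac{b_1b_{i+1}}{b_0^2}-\frac{(i+2)b_{i+2}}{b_0}$. 2. For every $n\ge0$, $$(-1)^nm_n=\frac{b_1b_{n+1}}{b_0^2}-\frac{(n+2)b_{n+2}}{b_0}-\sum_{k=0}^{n-1}\frac{(-1)^km_k\,b_{n-k}}{b_0}.$$ 3. For every $n\ge0$, $$\frac{b_n(\chi)}{b_0(\chi)}=\sum_{j=0}^{2n}(-1)^j\frac{a_{j+\mu}(\chi)}{a_\mu(\chi)}\,\frac{a_{2n-j+\mu}(\chi)}{a_\mu(\chi)}.$$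 4. Suppose that $b_n(\chi)/b_0(\chi)$ is real and positive for all $n\ge1$. Then $f(\cdot,\chi)$ has zeros with positive real part, and there is a smallest positive real part $s_1(\chi)>0$ of a zero of $f(\cdot,\chi)$. The generalized Riemann hypothesis for $L(s,\chi)$ (that is, the claim that $\xi(\frac12+is,\chi)$ as a function of $s$ has only real zeros) holds if and only if there is a real number $L>s_1(\chi)^{-2}$ such that $$\sum_{j=0}^{k}(-1)^j\binom kj\frac{m_{n+j}(\chi)}{L^{n+j}}\ge0\qquad\text{for all integers } n,k\ge0$$ (in particular, these sums are real). -/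

import Mathlib

open scoped ComplexOrder

noncomputable section

namespace DirichletCharacter

/-- The parity `κ` of a Dirichlet character: `0` if `χ (-1) = 1`, and `1` otherwise
(that is, if `χ (-1) = -1`). -/
def parity {q : ℕ} (χ : DirichletCharacter ℂ q) : ℕ :=
  open Classical in if χ.Even then 0 else 1

/-- The function `ξ(s, χ) = (q/π)^((s+κ)/2) Γ((s+κ)/2) L(s, χ)`, continued analytically.
Mathlib's `completedLFunction χ s` is the analytic continuation of
`π^(-(s+κ)/2) Γ((s+κ)/2) L(s, χ)`; it has the correct values also at the poles of the Gamma
factor, where the literal product is a junk value. See `xi_eq`. -/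
def xi {q : ℕ} [NeZero q] (χ : DirichletCharacter ℂ q) (s : ℂ) : ℂ :=
  (q : ℂ) ^ ((s + χ.parity) / 2) * completedLFunction χ s

/-- Away from the poles of the Gamma factor, `ξ(s, χ)` is the literal product. -/
theorem xi_eq {q : ℕ} [NeZero q] (hq : 1 < q) (χ : DirichletCharacter ℂ q) (s : ℂ)
    (hs : ∀ n : ℕ, s + χ.parity ≠ -(2 * n)) :
    χ.xi s = ((q : ℂ) / Real.pi) ^ ((s + χ.parity) / 2) *
      Complex.Gamma ((s + χ.parity) / 2) * LFunction χ s := by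
  have hG : gammaFactor χ s = Complex.Gammaℝ (s + χ.parity) := by
    unfold gammaFactor parity
    split_ifs <;> simp
  have hG0 : Complex.Gammaℝ (s + χ.parity) ≠ 0 := by
    rw [Ne, Complex.Gammaℝ_eq_zero_iff]
    push Not
    exact hs
  rw [LFunction_eq_completed_div_gammaFactor χ s (Or.inr hq.ne'), hG]
  have hpi : ((q : ℂ) / Real.pi) ^ ((s + χ.parity) / 2) =
      (q : ℂ) ^ ((s + χ.parity) / 2) * (Real.pi : ℂ) ^ (-(s + χ.parity) / 2) := by
    have h := Complex.mul_cpow_ofReal_nonneg (a := (q : ℝ)) (b := Real.pi⁻¹)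
      (Nat.cast_nonneg q) (inv_nonneg.2 Real.pi_pos.le) ((s + χ.parity) / 2)
    push_cast at h
    rw [div_eq_mul_inv, h, Complex.inv_cpow, neg_div, Complex.cpow_neg]
    rw [Complex.arg_ofReal_of_nonneg Real.pi_pos.le]
    exact Real.pi_ne_zero.symm
  rw [hpi, mul_assoc (_ ^ _), ← Complex.Gammaℝ_def, mul_assoc, mul_div_cancel₀ _ hG0, xi]

/-- `φ(y, χ) = 2 ∑_{n ≥ 1} n^κ χ(n) exp(-(n²π/q) e^{2y} + (κ + 1/2) y)`. -/
def phi {q : ℕ} (χ : DirichletCharacter ℂ q) (y : ℝ) : ℂ :=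
  2 * ∑' n : ℕ+, ((n : ℕ) : ℂ) ^ χ.parity * χ ((n : ℕ) : ZMod q) *
    (Real.exp (-(((n : ℕ) : ℝ) ^ 2 * Real.pi / q) * Real.exp (2 * y)
      + ((χ.parity : ℝ) + 1 / 2) * y) : ℂ)

/-- `a_n(χ) = (1/n!) ∫ y^n φ(y, χ) dy`, so that `ξ(1/2 + is, χ) = ∑ i^n a_n(χ) s^n`. -/
def aCoeff {q : ℕ} (χ : DirichletCharacter ℂ q) (n : ℕ) : ℂ :=
  (1 / (n.factorial : ℂ)) * ∫ y : ℝ, (y : ℂ) ^ n * χ.phi y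

/-- The number `μ`: the least `n` with `a_n(χ) ≠ 0`. -/
def mu {q : ℕ} (χ : DirichletCharacter ℂ q) : ℕ :=
  sInf {n : ℕ | χ.aCoeff n ≠ 0}

/-- `G(s, χ) = ξ(s, χ) ξ(s, χ̄)`; here `star χ` is the pointwise complex conjugate of `χ`. -/
def xiProd {q : ℕ} [NeZero q] (χ : DirichletCharacter ℂ q) (s : ℂ) : ℂ :=
  χ.xi s * DirichletCharacter.xi (star χ) s

/-- `f(s, χ) = s^(-2μ) G(1/2 + is, χ)`, with the removable singularity at `s = 0` removed. -/
def fFun {q : ℕ} [NeZero q] (χ : DirichletCharacter ℂ q) : ℂ → ℂ :=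
  Function.update (fun s => χ.xiProd (1 / 2 + Complex.I * s) / s ^ (2 * χ.mu)) 0
    (Filter.limUnder (nhdsWithin 0 {0}ᶜ)
      (fun s : ℂ => χ.xiProd (1 / 2 + Complex.I * s) / s ^ (2 * χ.mu)))

/-- `b_n(χ) = (-1)^μ ∑_{j ≤ 2n} a_{j+μ}(χ) a_{2n-j+μ}(χ̄)`. The global sign `(-1)^μ` makes
`f(s, χ) = ∑ (-1)^n b_n(χ) s^(2n)` hold; it cancels in the quotients `b_n(χ) / b_0(χ)`. -/
def bCoeff {q : ℕ} (χ : DirichletCharacter ℂ q) (n : ℕ) : ℂ :=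
  (-1) ^ χ.mu * ∑ j ∈ Finset.range (2 * n + 1),
    χ.aCoeff (j + χ.mu) * DirichletCharacter.aCoeff (star χ) (2 * n - j + χ.mu)

/-- `m_k(χ) = -1/((2k+3)!·2) (f'(s, χ)/f(s, χ))^{(2k+3)}` at `s = 0`. -/
def moment {q : ℕ} [NeZero q] (χ : DirichletCharacter ℂ q) (k : ℕ) : ℂ :=
  -(1 / (((2 * k + 3).factorial : ℂ) * 2)) *
    iteratedDeriv (2 * k + 3) (fun s => deriv χ.fFun s / χ.fFun s) 0

/-- The `(n+1) × (n+1)` matrix of the determinant formula. Its column `j < n` is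
`b_{i-j}/b_0` on and below the diagonal and `0` above it; its last column is
`b_1 b_{i+1}/b_0² - (i+2) b_{i+2}/b_0`. -/
def momentMatrix {q : ℕ} (χ : DirichletCharacter ℂ q) (n : ℕ) :
    Matrix (Fin (n + 1)) (Fin (n + 1)) ℂ :=
  Matrix.of fun i j =>
    if (j : ℕ) = n then
      χ.bCoeff 1 * χ.bCoeff (i + 1) / χ.bCoeff 0 ^ 2
        - ((i : ℕ) + 2) * χ.bCoeff (i + 2) / χ.bCoeff 0
    else if (j : ℕ) ≤ i then χ.bCoeff (i - j) / χ.bCoeff 0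
    else 0

/-- The generalized Riemann hypothesis for `L(s, χ)`: the function `s ↦ ξ(1/2 + is, χ)` has only
real zeros. -/
def GRH {q : ℕ} [NeZero q] (χ : DirichletCharacter ℂ q) : Prop :=
  ∀ s : ℂ, χ.xi (1 / 2 + Complex.I * s) = 0 → s.im = 0

end DirichletCharacter

end

/-! The logarithmic derivative of the even entire function `f` expands at the origin as `f'/f = -2
(b₁/b₀) s - 2 ∑ m_k s^(2k+3)`. Comparing coefficients in `f' = (f'/f) · f` gives a unitriangular
Toeplitz system for the numbers `(-1)^k m_k`. Its last row is the recursion and Cramer's rule is the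
determinant formula (`sum_moment_mul_bCoeff`, `moment_eq_det`). The functional equation sends `s` to
`-s` and the character to its conjugate; hence `a_n(χ̄)` is `(-1)^n a_n(χ)` up to a constant factor
(`neg_one_pow_mul_aCoeff`). This kills the odd coefficients of `f` and gives the formula for
`b_n/b₀`.

For the criterion, GRH says that `f` has only real zeros. If it does, then `m_n = (1/2) ∑ ρ^(-2n-4)`
over the zeros `ρ`, with multiplicity, in the sense of limits over growing discs. So `m_n / L^n` are
moments of a positive measure supported at the points `ρ^(-2)/L` of `[0, 1]`, and the alternating
sums are nonnegative (`moments_nonneg`). The sum over zeros does not need a Hadamard product: in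
each disc the zeros are divided out by a Blaschke product, Borel–Carathéodory and Cauchy bound the
rest, and the error tends to zero because `f` grows more slowly than every `exp(ε|s|²)`
(`exists_norm_add_sum_inv_pow_le`). That growth comes from the doubly exponential decay of `φ`,
which is a theta function.

Conversely, nonnegative alternating sums make `m_n / L^n` the moments of a continuous functional on
`C([0,1])` (`HausdorffMoment.exists_functional`). Applying it to `1/(1 - wt)` continues the
generating function to the plane cut along `[1, ∞)`. Hence `f'/f` continues to the set where `L s²`
avoids `[1, ∞)`, which contains every nonreal `s`. A zero of `f` would be a pole of `f'/f`, so no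
zero is nonreal (`im_eq_zero_of_moments`).

Positivity of `b_n/b₀` excludes zeros on the imaginary axis. It also makes `(f'/f)'(0)` nonzero,
which is impossible for a zero-free function of this growth. Zeros therefore exist, and since they
lie in a strip, one of them has least positive real part. -/

section

/-! ### Zeros of entire functions and Taylor coefficients of the logarithmic derivative -/

open Complex Filter Metric
open scoped Topology ComplexConjugate

namespace EntireFunction

variable {f : ℂ → ℂ}

theorem analyticOrderAt_ne_top (hf : Differentiable ℂ f) (h0 : f 0 ≠ 0) (w : ℂ) :
    analyticOrderAt f w ≠ ⊤ := by
  intro h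
  rw [analyticOrderAt_eq_top] at h
  have := AnalyticOnNhd.eqOn_of_preconnected_of_eventuallyEq (f := f) (g := fun _ => 0)
    (U := Set.univ) (fun z _ => hf.analyticAt z) (fun z _ => analyticAt_const)
    isPreconnected_univ (Set.mem_univ w) h
  exact h0 (this (Set.mem_univ 0))

theorem exists_eq_pow_mul (hf : Differentiable ℂ f) {w : ℂ} (hw : analyticOrderAt f w ≠ ⊤) :
    ∃ G : ℂ → ℂ, Differentiable ℂ G ∧ G w ≠ 0 ∧
      ∀ z, f z = (z - w) ^ analyticOrderNatAt f w * G z := by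
  obtain ⟨g, hg, hg0, hfg⟩ := (hf.analyticAt w).analyticOrderAt_ne_top.1 hw
  set n := analyticOrderNatAt f w
  let G : ℂ → ℂ := fun z => if z = w then g w else f z / (z - w) ^ n
  have hGg : G =ᶠ[𝓝 w] g := by
    filter_upwards [hfg] with z hz
    by_cases h : z = w
    · simp [G, h]
    · have : (z - w) ^ n ≠ 0 := pow_ne_zero _ (sub_ne_zero.2 h)
      simp only [G, if_neg h, hz, smul_eq_mul]
      field_simp
  refine ⟨G, fun z => ?_, by simpa [G] using hg0, fun z => ?_⟩
  · by_cases h : z = w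
    · subst h
      exact hg.differentiableAt.congr_of_eventuallyEq hGg
    · have h1 : DifferentiableAt ℂ (fun z => f z / (z - w) ^ n) z :=
        (hf z).div (by fun_prop) (pow_ne_zero _ (sub_ne_zero.2 h))
      refine h1.congr_of_eventuallyEq ?_
      filter_upwards [isOpen_ne.mem_nhds h] with y hy
      simp only [G, if_neg hy]
  · by_cases h : z = w
    · subst h
      simpa [G] using hfg.self_of_nhds
    · have : (z - w) ^ n ≠ 0 := pow_ne_zero _ (sub_ne_zero.2 h)
      simp only [G, if_neg h]
      field_simp

theorem exists_eq_prod_mul (hf : Differentiable ℂ f) (h0 : f 0 ≠ 0) (S : Finset ℂ) :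
    ∃ G : ℂ → ℂ, Differentiable ℂ G ∧ (∀ w ∈ S, G w ≠ 0) ∧
      ∀ z, f z = (∏ w ∈ S, (z - w) ^ analyticOrderNatAt f w) * G z := by
  classical
  induction S using Finset.induction_on with
  | empty => exact ⟨f, hf, by simp, by simp⟩
  | insert a S ha ih =>
    obtain ⟨G, hG, hGS, hfG⟩ := ih
    have hG0 : G 0 ≠ 0 := fun h => h0 (by rw [hfG, h, mul_zero])
    obtain ⟨H, hH, hHa, hGH⟩ := exists_eq_pow_mul hG (analyticOrderAt_ne_top hG hG0 a)
    have hprod : ∏ w ∈ S, (a - w) ^ analyticOrderNatAt f w ≠ 0 :=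
      Finset.prod_ne_zero_iff.2 fun w hw =>
        pow_ne_zero _ (sub_ne_zero.2 fun h => ha (h ▸ hw))
    -- The factors already split off do not vanish at `a`, so the cofactor `G` carries the full
    -- order of `f` there.
    have hord : analyticOrderAt f a = (analyticOrderNatAt G a : ℕ∞) := by
      rw [(hf.analyticAt a).analyticOrderAt_eq_natCast]
      refine ⟨fun z => (∏ w ∈ S, (z - w) ^ analyticOrderNatAt f w) * H z,
        Differentiable.analyticAt (by fun_prop) a, mul_ne_zero hprod hHa,
        Eventually.of_forall fun z => ?_⟩
      rw [hfG, hGH, smul_eq_mul]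
      ring
    have hord' : analyticOrderNatAt f a = analyticOrderNatAt G a := by
      rw [analyticOrderNatAt, hord, ENat.toNat_natCast]
    refine ⟨H, hH, fun w hw => ?_, fun z => ?_⟩
    · rcases Finset.mem_insert.1 hw with rfl | hw
      · exact hHa
      · intro h
        exact hGS w hw (by rw [hGH, h, mul_zero])
    · rw [Finset.prod_insert ha, hfG, hGH, hord']
      ring

/-- The zeros of an entire function in the open disc of radius `R` about the origin. -/
noncomputable def zerosIn (f : ℂ → ℂ) (R : ℝ) : Finset ℂ :=
  open Classical in
  if h : {w : ℂ | ‖w‖ < R ∧ f w = 0}.Finite then h.toFinset else ∅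

theorem finite_zeros (hf : Differentiable ℂ f) (h0 : f 0 ≠ 0) (R : ℝ) :
    {w : ℂ | ‖w‖ < R ∧ f w = 0}.Finite := by
  have hcod : f ⁻¹' {0}ᶜ ∈ codiscrete ℂ :=
    AnalyticOnNhd.preimage_zero_mem_codiscrete (fun z _ => hf.analyticAt z) h0
  refine ((isCompact_closedBall (0 : ℂ) R).finite_sdiff_of_mem_codiscreteWithin
    (codiscreteWithin_mono (Set.subset_univ _) hcod)).subset fun w hw => ?_
  exact ⟨by simpa using hw.1.le, by simpa using hw.2⟩

theorem mem_zerosIn (hf : Differentiable ℂ f) (h0 : f 0 ≠ 0) {R : ℝ} {w : ℂ} :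
    w ∈ zerosIn f R ↔ ‖w‖ < R ∧ f w = 0 := by
  rw [zerosIn, dif_pos (finite_zeros hf h0 R)]
  simp

theorem iteratedDeriv_inv_sub (m : ℕ) (w : ℂ) :
    iteratedDeriv m (fun z : ℂ => (z - w)⁻¹) 0 = -(m.factorial * (w⁻¹) ^ (m + 1)) := by
  have := congrFun (iter_deriv_inv_linear_sub (𝕜 := ℂ) m 1 w) 0
  rw [iteratedDeriv_eq_iterate]
  simp only [one_mul, one_pow, mul_one, zero_sub] at this
  rw [this, show (-1 - (m : ℤ)) = -((m + 1 : ℕ) : ℤ) by push_cast; ring, zpow_neg, zpow_natCast,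
    ← inv_pow, inv_neg, neg_pow w⁻¹, pow_succ (-1 : ℂ)]
  have : ((-1 : ℂ) ^ m) * (-1) ^ m = 1 := by rw [← mul_pow]; simp
  linear_combination (-(m.factorial * (w⁻¹) ^ (m + 1))) * this

/-- On the circle `R² = z̄ z`, so the numerator is the conjugate of `z - w` times `z`. This is the
unimodularity of Blaschke factors. -/
theorem norm_sq_sub_conj_mul {R : ℝ} (hR : 0 < R) {z : ℂ} (hz : ‖z‖ = R) (w : ℂ) :
    ‖((R : ℂ) ^ 2 - conj w * z) / R‖ = ‖z - w‖ := by
  have h : (R : ℂ) ^ 2 = conj z * z := by rw [conj_mul', hz]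
  rw [h, ← sub_mul, norm_div, norm_mul, ← map_sub, RCLike.norm_conj, hz, norm_real,
    Real.norm_of_nonneg hR.le, mul_div_assoc, div_self hR.ne', mul_one]

/-- Division by the finite Blaschke product of the zeros in a disc. -/
theorem exists_blaschke_quotient (hf : Differentiable ℂ f) (h0 : f 0 ≠ 0) {R M : ℝ} (hR : 0 < R)
    (hM : ∀ z, ‖z‖ = R → ‖f z‖ ≤ M) :
    ∃ B : ℂ → ℂ, Differentiable ℂ B ∧ (∀ z, ‖z‖ < R → B z ≠ 0) ∧ (∀ z, ‖z‖ < R → ‖B z‖ ≤ M) ∧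
      ‖f 0‖ ≤ ‖B 0‖ ∧ ∀ᶠ z in 𝓝 0, logDeriv f z = logDeriv B z +
        ∑ w ∈ zerosIn f R, (analyticOrderNatAt f w : ℂ) *
          ((z - w)⁻¹ - (z - R ^ 2 / conj w)⁻¹) := by
  obtain ⟨G, hG, hGS, hfG⟩ := exists_eq_prod_mul hf h0 (zerosIn f R)
  set S := zerosIn f R with hS
  set n := analyticOrderNatAt f with hn
  have hmem : ∀ w ∈ S, ‖w‖ < R ∧ f w = 0 := fun w hw => (mem_zerosIn hf h0).1 hw
  have hw0 : ∀ w ∈ S, w ≠ 0 := fun w hw h => h0 (h ▸ (hmem w hw).2)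
  have hGne : ∀ z, ‖z‖ < R → G z ≠ 0 := by
    intro z hz h
    have : f z = 0 := by rw [hfG, h, mul_zero]
    exact hGS z ((mem_zerosIn hf h0).2 ⟨hz, this⟩) h
  have hRC : (R : ℂ) ≠ 0 := ofReal_ne_zero.2 hR.ne'
  have hfac : ∀ w ∈ S, ∀ z, ‖z‖ < R → (R : ℂ) ^ 2 - conj w * z ≠ 0 := by
    intro w hw z hz h
    have h1 : ‖(R : ℂ) ^ 2‖ = ‖conj w * z‖ := by rw [sub_eq_zero.1 h]
    rw [norm_mul, RCLike.norm_conj, norm_pow, norm_real, Real.norm_of_nonneg hR.le] at h1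
    nlinarith [norm_nonneg w, norm_nonneg z, (hmem w hw).1]
  -- Each factor `z - w` of `f` is replaced by its reflection in the circle, which has the same
  -- modulus on the circle and no zero inside. This keeps `B` entire, and the maximum principle
  -- carries the bound for `f` on the circle to `B` inside.
  let B : ℂ → ℂ := fun z => (∏ w ∈ S, (((R : ℂ) ^ 2 - conj w * z) / R) ^ n w) * G z
  have hBd : Differentiable ℂ B := by
    refine Differentiable.mul (Differentiable.fun_finsetProd fun w _ => ?_) hG
    fun_prop
  have hsph : ∀ z, ‖z‖ = R → ‖B z‖ ≤ M := by
    intro z hz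
    have : ‖B z‖ = ‖f z‖ := by
      simp only [B, hfG z, norm_mul, norm_prod, norm_pow]
      congr 1
      exact Finset.prod_congr rfl fun w _ => by rw [norm_sq_sub_conj_mul hR hz]
    exact this ▸ hM z hz
  refine ⟨B, hBd, fun z hz => ?_, fun z hz => ?_, ?_, ?_⟩
  · exact mul_ne_zero (Finset.prod_ne_zero_iff.2 fun w hw =>
      pow_ne_zero _ (div_ne_zero (hfac w hw z hz) hRC)) (hGne z hz)
  · refine norm_le_of_forall_mem_frontier_norm_le (U := ball 0 R) isBounded_ball
      hBd.diffContOnCl (fun y hy => ?_) (subset_closure (by simpa using hz))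
    rw [frontier_ball _ hR.ne'] at hy
    exact hsph y (by simpa using hy)
  · simp only [B, hfG 0, norm_mul, norm_prod, norm_pow]
    refine mul_le_mul_of_nonneg_right (Finset.prod_le_prod (fun _ _ => by positivity)
      fun w hw => pow_le_pow_left₀ (norm_nonneg _) ?_ _) (norm_nonneg _)
    rw [mul_zero, sub_zero, zero_sub, norm_neg, sq, mul_div_assoc, div_self hRC, mul_one,
      norm_real, Real.norm_of_nonneg hR.le]
    exact (hmem w hw).1.le
  · have e1 : ∀ᶠ z in 𝓝 (0 : ℂ), f z ≠ 0 := hf.continuous.continuousAt.eventually_ne h0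
    have e2 : ∀ᶠ z in 𝓝 (0 : ℂ), ‖z‖ < R := by
      filter_upwards [ball_mem_nhds (0 : ℂ) hR] with z hz using by simpa using hz
    filter_upwards [e1, e2] with z hz hzR
    have hsub : ∀ w ∈ S, z - w ≠ 0 := fun w hw =>
      sub_ne_zero.2 fun h => hz (h ▸ (hmem w hw).2)
    have l1 : logDeriv f z = ∑ w ∈ S, (n w : ℂ) * (z - w)⁻¹ + logDeriv G z := by
      rw [funext hfG, logDeriv_mul (f := fun z => ∏ w ∈ S, (z - w) ^ n w) (g := G) z
        (Finset.prod_ne_zero_iff.2 fun w hw => pow_ne_zero _ (hsub w hw)) (hGne z hzR)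
        (by fun_prop) (hG z), logDeriv_prod (𝕜 := ℂ) (f := fun w z => (z - w) ^ n w)
        (fun w hw => pow_ne_zero _ (hsub w hw))
        (fun w _ => by fun_prop)]
      congr 1
      refine Finset.sum_congr rfl fun w hw => ?_
      rw [logDeriv_fun_pow (𝕜 := ℂ) (f := fun z => z - w) (by fun_prop), logDeriv_apply]
      simp
    have l2 : logDeriv B z =
        ∑ w ∈ S, (n w : ℂ) * (z - R ^ 2 / conj w)⁻¹ + logDeriv G z := by
      rw [logDeriv_mul (f := fun z => ∏ w ∈ S, (((R : ℂ) ^ 2 - conj w * z) / R) ^ n w) (g := G) z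
        (Finset.prod_ne_zero_iff.2 fun w hw =>
          pow_ne_zero _ (div_ne_zero (hfac w hw z hzR) hRC)) (hGne z hzR)
        (by fun_prop) (hG z), logDeriv_prod (𝕜 := ℂ)
        (f := fun w z => (((R : ℂ) ^ 2 - conj w * z) / R) ^ n w)
        (fun w hw => pow_ne_zero _ (div_ne_zero (hfac w hw z hzR) hRC))
        (fun w _ => by fun_prop)]
      congr 1
      refine Finset.sum_congr rfl fun w hw => ?_
      rw [logDeriv_fun_pow (𝕜 := ℂ) (f := fun z => ((R : ℂ) ^ 2 - conj w * z) / R)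
        (by fun_prop), logDeriv_apply]
      have hd : deriv (fun z => ((R : ℂ) ^ 2 - conj w * z) / R) z = -conj w / R := by
        have : HasDerivAt (fun z => ((R : ℂ) ^ 2 - conj w * z) / R) (-(conj w * 1) / R) z :=
          (((hasDerivAt_id z).const_mul (conj w)).const_sub _).div_const _
        simpa using this.deriv
      have hc : conj w ≠ 0 := by simpa using hw0 w hw
      have h3 := hfac w hw z hzR
      rw [hd]
      congr 1
      rw [show z - (R : ℂ) ^ 2 / conj w = -((R ^ 2 - conj w * z) / conj w) by field_simp; ring,
        inv_neg, inv_div]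
      field_simp
    rw [l1, l2]
    simp only [mul_sub, Finset.sum_sub_distrib]
    ring

theorem exists_log_of_ne_zero {B : ℂ → ℂ} {R : ℝ} (hR : 0 < R) (hB : Differentiable ℂ B)
    (h : ∀ z, ‖z‖ < R → B z ≠ 0) :
    ∃ u : ℂ → ℂ, u 0 = 0 ∧ (∀ z ∈ ball (0 : ℂ) R, HasDerivAt u (logDeriv B z) z) ∧
      ∀ z ∈ ball (0 : ℂ) R, B z = B 0 * exp (u z) := by
  have hne : ∀ z ∈ ball (0 : ℂ) R, B z ≠ 0 := fun z hz => h z (by simpa using hz)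
  have hd : DifferentiableOn ℂ (logDeriv B) (ball 0 R) :=
    ((hB.contDiff (n := 2)).differentiable_deriv_two.differentiableOn).div
      hB.differentiableOn hne
  obtain ⟨u, hu0, hu⟩ := hd.isExactOn_ball.with_val_at 0 0
  refine ⟨u, hu0, hu, fun z hz => ?_⟩
  have hder : ∀ y ∈ ball (0 : ℂ) R, HasDerivAt (fun z => B z * exp (-u z)) 0 y := by
    intro y hy
    have h1 := (hB y).hasDerivAt.mul ((hu y hy).neg.cexp)
    convert! h1 using 1
    rw [logDeriv_apply]
    field_simp [hne y hy]
    ring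
  have hconst := (convex_ball (0 : ℂ) R).is_const_of_fderivWithin_eq_zero (𝕜 := ℂ)
    (f := fun z => B z * exp (-u z))
    (fun y hy => (hder y hy).differentiableAt.differentiableWithinAt)
    (fun y hy => by
      rw [fderivWithin_of_isOpen isOpen_ball hy, (hder y hy).hasFDerivAt.fderiv]
      ext; simp)
    hz (mem_ball_self hR)
  simp only [hu0, neg_zero, exp_zero, mul_one] at hconst
  rw [← hconst, mul_assoc, ← exp_add, neg_add_cancel, exp_zero, mul_one]

/-- The Taylor coefficients of the logarithmic derivative of an entire function, up to an error
governed by the growth of the function, in terms of its zeros. -/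
theorem norm_iteratedDeriv_logDeriv_add_sum_le (hf : Differentiable ℂ f) (h0 : f 0 ≠ 0)
    {R A : ℝ} (hR : 0 < R) (hA : 0 < A) (hM : ∀ z, ‖z‖ = R → ‖f z‖ ≤ ‖f 0‖ * Real.exp A)
    (k : ℕ) :
    ‖iteratedDeriv k (logDeriv f) 0 / k.factorial +
      ∑ w ∈ zerosIn f R, (analyticOrderNatAt f w : ℂ) *
        (w⁻¹ ^ (k + 1) - (conj w / R ^ 2) ^ (k + 1))‖ ≤ (k + 1) * (2 * A) * (2 / R) ^ (k + 1) := by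
  obtain ⟨B, hB, hBne, hBM, hB0, hlog⟩ := exists_blaschke_quotient hf h0 hR hM
  obtain ⟨u, hu0, hu, hBu⟩ := exists_log_of_ne_zero hR hB hBne
  have hB00 : 0 < ‖B 0‖ := norm_pos_iff.2 (hBne 0 (by simpa using hR))
  have hud : DifferentiableOn ℂ u (ball 0 R) :=
    fun z hz => (hu z hz).differentiableAt.differentiableWithinAt
  -- Here `u = log (B / B 0)`. The inequality `‖f 0‖ ≤ ‖B 0‖` turns the bound on `B` into a
  -- one-sided bound on the real part of `u`.
  have hure : Set.MapsTo u (ball 0 R) {z | z.re ≤ A} := by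
    intro z hz
    have h1 := hBM z (by simpa using hz)
    rw [hBu z hz, norm_mul, norm_exp] at h1
    have h2 : ‖B 0‖ * Real.exp (u z).re ≤ ‖B 0‖ * Real.exp A :=
      h1.trans (mul_le_mul_of_nonneg_right hB0 (Real.exp_pos _).le)
    exact Real.exp_le_exp.1 (le_of_mul_le_mul_left h2 hB00)
  -- Borel–Carathéodory on the circle of radius `R / 2` gives `‖u‖ ≤ 2A`, and Cauchy's estimate is
  -- applied on that circle.
  have hcauchy : ‖iteratedDeriv (k + 1) u 0‖ ≤ (k + 1).factorial * (2 * A) / (R / 2) ^ (k + 1) := by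
    refine norm_iteratedDeriv_le_of_forall_mem_sphere_norm_le (k + 1) (by positivity)
      (DifferentiableOn.diffContOnCl (hud.mono ?_)) fun z hz => ?_
    · exact closure_ball_subset_closedBall.trans (closedBall_subset_ball (by linarith))
    · have hz' : ‖z‖ = R / 2 := by simpa using hz
      refine (borelCaratheodory_zero hA hud hure hR (by simp [hz']; linarith) hu0).trans ?_
      rw [hz', show R - R / 2 = R / 2 by ring, mul_div_assoc, div_self (by positivity), mul_one]
  have hderiv : iteratedDeriv (k + 1) u 0 = iteratedDeriv k (logDeriv B) 0 := by
    rw [iteratedDeriv_succ']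
    refine Filter.EventuallyEq.iteratedDeriv_eq k ?_
    filter_upwards [ball_mem_nhds (0 : ℂ) hR] with z hz using (hu z hz).deriv
  have hmem : ∀ w ∈ zerosIn f R, w ≠ 0 := fun w hw h =>
    h0 (h ▸ ((mem_zerosIn hf h0).1 hw).2)
  have hRC : (R : ℂ) ≠ 0 := ofReal_ne_zero.2 hR.ne'
  have hcd : ∀ w : ℂ, w ≠ 0 → ContDiffAt ℂ k (fun z : ℂ => (z - w)⁻¹) 0 := fun w hw =>
    ContDiffAt.inv (by fun_prop) (by simpa using hw)
  have hcd2 : ∀ w ∈ zerosIn f R, (R : ℂ) ^ 2 / conj w ≠ 0 := fun w hw =>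
    div_ne_zero (pow_ne_zero _ hRC) (by simpa using hmem w hw)
  have hBan : ContDiffAt ℂ k (logDeriv B) 0 :=
    ((hB.analyticAt 0).deriv.div (hB.analyticAt 0) (hBne 0 (by simpa using hR))).contDiffAt
  have hsum : iteratedDeriv k (logDeriv f) 0 = iteratedDeriv k (logDeriv B) 0 +
      ∑ w ∈ zerosIn f R, (analyticOrderNatAt f w : ℂ) *
        (-(k.factorial * w⁻¹ ^ (k + 1)) + k.factorial * (conj w / R ^ 2) ^ (k + 1)) := by
    rw [Filter.EventuallyEq.iteratedDeriv_eq k hlog, iteratedDeriv_fun_add hBan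
      (ContDiffAt.sum fun w hw => contDiffAt_const.mul
        ((hcd w (hmem w hw)).sub (hcd _ (hcd2 w hw)))),
      iteratedDeriv_fun_sum fun w hw => contDiffAt_const.mul
        ((hcd w (hmem w hw)).sub (hcd _ (hcd2 w hw)))]
    congr 1
    refine Finset.sum_congr rfl fun w hw => ?_
    rw [iteratedDeriv_const_mul_field, iteratedDeriv_fun_sub (hcd w (hmem w hw))
      (hcd _ (hcd2 w hw)), iteratedDeriv_inv_sub, iteratedDeriv_inv_sub, inv_div]
    ring
  have hk : (k.factorial : ℂ) ≠ 0 := Nat.cast_ne_zero.2 k.factorial_ne_zero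
  have hfin : iteratedDeriv k (logDeriv f) 0 / k.factorial +
      ∑ w ∈ zerosIn f R, (analyticOrderNatAt f w : ℂ) *
        (w⁻¹ ^ (k + 1) - (conj w / R ^ 2) ^ (k + 1)) =
      iteratedDeriv (k + 1) u 0 / k.factorial := by
    rw [hsum, hderiv, add_div, Finset.sum_div, add_assoc, ← Finset.sum_add_distrib,
      Finset.sum_eq_zero, add_zero]
    intro w _
    field_simp
    ring
  rw [hfin, norm_div, norm_natCast, div_le_iff₀ (by positivity)]
  refine hcauchy.trans (le_of_eq ?_)
  rw [Nat.factorial_succ, div_pow, div_pow]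
  push_cast
  field_simp

end EntireFunction

end

/-! ### Sums over real zeros for functions of growth below a Gaussian -/

section

open Complex Filter Metric
open scoped Topology ComplexConjugate

namespace EntireFunction

variable {f : ℂ → ℂ}

/-- The growth condition `log |f z| = o(|z|²)`. -/
def SubGaussian (f : ℂ → ℂ) : Prop :=
  ∀ ε : ℝ, 0 < ε → ∃ C : ℝ, ∀ z, ‖f z‖ ≤ C * Real.exp (ε * ‖z‖ ^ 2)

theorem SubGaussian.exists_le (hf : SubGaussian f) (h0 : f 0 ≠ 0) {ε : ℝ} (hε : 0 < ε) :
    ∃ C : ℝ, 0 < C ∧ ∀ z, ‖f z‖ ≤ ‖f 0‖ * Real.exp (C + ε * ‖z‖ ^ 2) := by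
  obtain ⟨C, hC⟩ := hf ε hε
  have h0' : 0 < ‖f 0‖ := norm_pos_iff.2 h0
  refine ⟨|C| / ‖f 0‖ + 1, by positivity, fun z => (hC z).trans ?_⟩
  rw [Real.exp_add, ← mul_assoc]
  refine mul_le_mul_of_nonneg_right ?_ (Real.exp_pos _).le
  have h1 := Real.add_one_le_exp (|C| / ‖f 0‖ + 1)
  calc C ≤ |C| := le_abs_self C
    _ = ‖f 0‖ * (|C| / ‖f 0‖) := by field_simp
    _ ≤ _ := mul_le_mul_of_nonneg_left (by linarith) h0'.le

/-- A function without zeros of order of growth less than two has an affine logarithm. -/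
theorem SubGaussian.iteratedDeriv_logDeriv_eq_zero (hg : SubGaussian f) (hf : Differentiable ℂ f)
    (hne : ∀ z, f z ≠ 0) : iteratedDeriv 1 (logDeriv f) 0 = 0 := by
  have hS : ∀ R, zerosIn f R = ∅ := fun R =>
    Finset.eq_empty_of_forall_notMem fun w hw => hne w ((mem_zerosIn hf (hne 0)).1 hw).2
  have key : ∀ ε : ℝ, 0 < ε → ‖iteratedDeriv 1 (logDeriv f) 0‖ ≤ 32 * ε := by
    intro ε hε
    obtain ⟨C, hC, hb⟩ := hg.exists_le (hne 0) hε
    -- This radius balances the two parts of the exponent, `C = ε R²`, so the powers of `R` cancel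
    -- in the estimate.
    set R := Real.sqrt (C / ε) with hRdef
    have hR : 0 < R := Real.sqrt_pos.2 (by positivity)
    have hR2 : R ^ 2 = C / ε := Real.sq_sqrt (by positivity)
    have := norm_iteratedDeriv_logDeriv_add_sum_le hf (hne 0) hR
      (A := C + ε * R ^ 2) (by positivity) (fun z hz => hz ▸ hb z) 1
    rw [hS, Finset.sum_empty, add_zero] at this
    simp only [Nat.factorial_one, Nat.cast_one, div_one] at this
    refine this.trans (le_of_eq ?_)
    rw [div_pow, hR2]
    field_simp
    ring
  by_contra h
  have hpos : 0 < ‖iteratedDeriv 1 (logDeriv f) 0‖ := norm_pos_iff.2 h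
  have := key (‖iteratedDeriv 1 (logDeriv f) 0‖ / 64) (by positivity)
  linarith

/-- The degree-one coefficient estimate at radius `2R` bounds the sum of `w⁻² - (w/(2R)²)²` over the
zeros independently of `R`. For real `w` in the disc these terms are nonnegative, and for `|w| < R`
each is at least `1/(2R²)`. So the number of zeros up to `R` is `O(R²)`. -/
theorem SubGaussian.exists_sum_order_le (hg : SubGaussian f) (hf : Differentiable ℂ f)
    (h0 : f 0 ≠ 0) (hreal : ∀ z, f z = 0 → z.im = 0) :
    ∃ C : ℝ, 0 ≤ C ∧ ∀ R : ℝ, 1 ≤ R →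
      ∑ w ∈ zerosIn f R, (analyticOrderNatAt f w : ℝ) ≤ C * R ^ 2 := by
  obtain ⟨C, hC, hb⟩ := hg.exists_le h0 one_pos
  set p := iteratedDeriv 1 (logDeriv f) 0
  refine ⟨2 * (‖p‖ + 4 * C + 16), by positivity, fun R hR => ?_⟩
  have hR0 : 0 < R := by linarith
  have hest := norm_iteratedDeriv_logDeriv_add_sum_le hf h0 (R := 2 * R) (by positivity)
      (A := C + 1 * (2 * R) ^ 2) (by positivity) (fun z hz => hz ▸ hb z) 1
  simp only [Nat.factorial_one, Nat.cast_one, div_one] at hest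
  set g : ℂ → ℝ := fun w => (analyticOrderNatAt f w : ℝ) *
      ((w.re⁻¹) ^ 2 - (w.re / (2 * R) ^ 2) ^ 2) with hgdef
  have hcast : ∑ w ∈ zerosIn f (2 * R), (analyticOrderNatAt f w : ℂ) *
      (w⁻¹ ^ (1 + 1) - (conj w / ((2 * R : ℝ) : ℂ) ^ 2) ^ (1 + 1)) =
      ((∑ w ∈ zerosIn f (2 * R), g w : ℝ) : ℂ) := by
    push_cast
    refine Finset.sum_congr rfl fun w hw => ?_
    have him := hreal w ((mem_zerosIn hf h0).1 hw).2
    have hw' : w = (w.re : ℂ) := Complex.ext rfl (by simp [him])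
    rw [hw', conj_ofReal]
    simp [hgdef]
  have hre0 : ∀ w, f w = 0 → 0 < w.re ^ 2 ∧ ‖w‖ = |w.re| := by
    intro w hw
    have him := hreal w hw
    have hw' : w = (w.re : ℂ) := Complex.ext rfl (by simp [him])
    refine ⟨by
      have : w.re ≠ 0 := fun h => h0 (by rw [h] at hw'; simpa [hw'] using hw)
      positivity, ?_⟩
    conv_lhs => rw [hw', norm_real, Real.norm_eq_abs]
  have hlow : ∀ w, f w = 0 → ∀ c : ℝ, w.re ^ 2 ≤ c → c ≤ (2 * R) ^ 2 →
      c⁻¹ - c / (2 * R) ^ 4 ≤ (w.re⁻¹) ^ 2 - (w.re / (2 * R) ^ 2) ^ 2 := by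
    intro w hw c hc _
    have h1 := (hre0 w hw).1
    rw [inv_pow, div_pow, ← pow_mul]
    exact sub_le_sub (inv_anti₀ h1 hc) (by gcongr)
  have hnn : ∀ w ∈ zerosIn f (2 * R), 0 ≤ g w := by
    intro w hw
    obtain ⟨hwR, hw0⟩ := (mem_zerosIn hf h0).1 hw
    have h2 := hre0 w hw0
    rw [h2.2] at hwR
    have h3 : w.re ^ 2 ≤ (2 * R) ^ 2 := by
      rw [← sq_abs]; exact pow_le_pow_left₀ (abs_nonneg _) hwR.le 2
    have := hlow w hw0 _ h3 le_rfl
    refine mul_nonneg (Nat.cast_nonneg _) (le_trans (le_of_eq ?_) this)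
    field_simp
    ring
  have hin : ∀ w ∈ zerosIn f R, (analyticOrderNatAt f w : ℝ) / (2 * R ^ 2) ≤ g w := by
    intro w hw
    obtain ⟨hwR, hw0⟩ := (mem_zerosIn hf h0).1 hw
    have h2 := hre0 w hw0
    rw [h2.2] at hwR
    have h3 : w.re ^ 2 ≤ R ^ 2 := by
      rw [← sq_abs]; exact pow_le_pow_left₀ (abs_nonneg _) hwR.le 2
    have := hlow w hw0 _ h3 (by nlinarith)
    rw [hgdef, div_eq_mul_inv]
    refine mul_le_mul_of_nonneg_left (le_trans ?_ this) (Nat.cast_nonneg _)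
    have : (R ^ 2)⁻¹ - R ^ 2 / (2 * R) ^ 4 = 15 / 8 * (2 * R ^ 2)⁻¹ := by
      field_simp
      ring
    rw [this]
    have : 0 < (2 * R ^ 2)⁻¹ := by positivity
    linarith
  have hsub : zerosIn f R ⊆ zerosIn f (2 * R) := fun w hw =>
    (mem_zerosIn hf h0).2 ⟨((mem_zerosIn hf h0).1 hw).1.trans (by linarith),
      ((mem_zerosIn hf h0).1 hw).2⟩
  have hsum : (∑ w ∈ zerosIn f R, (analyticOrderNatAt f w : ℝ)) / (2 * R ^ 2) ≤
      ∑ w ∈ zerosIn f (2 * R), g w := by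
    rw [Finset.sum_div]
    exact (Finset.sum_le_sum hin).trans
      (Finset.sum_le_sum_of_subset_of_nonneg hsub fun w hw _ => hnn w hw)
  rw [hcast] at hest
  have hT : ∑ w ∈ zerosIn f (2 * R), g w ≤ ‖p‖ + 4 * C + 16 := by
    have h1 : ∑ w ∈ zerosIn f (2 * R), g w ≤ ‖((∑ w ∈ zerosIn f (2 * R), g w : ℝ) : ℂ)‖ := by
      rw [norm_real]; exact le_abs_self _
    have h2 := norm_sub_le (p + ((∑ w ∈ zerosIn f (2 * R), g w : ℝ) : ℂ)) p
    rw [add_sub_cancel_left] at h2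
    have h3 : (1 + 1) * (2 * (C + 1 * (2 * R) ^ 2)) * (2 / (2 * R)) ^ (1 + 1) =
        4 * C / R ^ 2 + 16 := by
      rw [show 2 / (2 * R) = 1 / R by field_simp, div_pow]
      field_simp
      ring
    have h4 : 4 * C / R ^ 2 ≤ 4 * C := div_le_self (by positivity) (one_le_pow₀ hR)
    linarith
  rw [div_le_iff₀ (by positivity)] at hsum
  calc _ ≤ _ := hsum
    _ ≤ (‖p‖ + 4 * C + 16) * (2 * R ^ 2) := by gcongr
    _ = _ := by ring

/-- For real zeros and growth below that of a Gaussian, the Taylor coefficients of the logarithmic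
derivative of degree at least three are the negative power sums of the zeros. -/
theorem SubGaussian.exists_norm_add_sum_inv_pow_le (hg : SubGaussian f)
    (hf : Differentiable ℂ f) (h0 : f 0 ≠ 0) (hreal : ∀ z, f z = 0 → z.im = 0) {k : ℕ}
    (hk : 3 ≤ k) :
    ∃ D : ℝ, ∀ R : ℝ, 1 ≤ R →
      ‖iteratedDeriv k (logDeriv f) 0 / k.factorial +
        ∑ w ∈ zerosIn f R, (analyticOrderNatAt f w : ℂ) * w⁻¹ ^ (k + 1)‖ ≤ D / R ^ 2 := by
  obtain ⟨C, hC, hb⟩ := hg.exists_le h0 one_pos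
  obtain ⟨N, hN0, hN⟩ := hg.exists_sum_order_le hf h0 hreal
  refine ⟨(k + 1) * (2 * (C + 1)) * 2 ^ (k + 1) + N, fun R hR => ?_⟩
  have hR0 : 0 < R := by linarith
  have hest := norm_iteratedDeriv_logDeriv_add_sum_le hf h0 hR0
      (A := C + 1 * R ^ 2) (by positivity) (fun z hz => hz ▸ hb z) k
  -- The condition `3 ≤ k` gives two spare powers of `R²`. One absorbs the growth exponent or the
  -- count `O(R²)` of reflected terms, and the other remains as the error `O(R⁻²)`.
  have hpow : R ^ 4 ≤ R ^ (k + 1) := pow_le_pow_right₀ hR (by omega)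
  have hR2 : 1 ≤ R ^ 2 := one_le_pow₀ hR
  have hfirst : (k + 1) * (2 * (C + 1 * R ^ 2)) * (2 / R) ^ (k + 1) ≤
      (k + 1) * (2 * (C + 1)) * 2 ^ (k + 1) / R ^ 2 := by
    have h1 : C + 1 * R ^ 2 ≤ (C + 1) * R ^ 2 := by nlinarith
    have h2 : (2 / R) ^ (k + 1) ≤ 2 ^ (k + 1) / R ^ 4 := by
      rw [div_pow]; gcongr
    calc (k + 1) * (2 * (C + 1 * R ^ 2)) * (2 / R) ^ (k + 1)
        ≤ (k + 1) * (2 * ((C + 1) * R ^ 2)) * (2 ^ (k + 1) / R ^ 4) := by gcongr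
      _ = _ := by field_simp
  have hsecond : ‖∑ w ∈ zerosIn f R, (analyticOrderNatAt f w : ℂ) *
      (conj w / R ^ 2) ^ (k + 1)‖ ≤ N / R ^ 2 := by
    calc _ ≤ ∑ w ∈ zerosIn f R, (analyticOrderNatAt f w : ℝ) * (1 / R ^ 4) := by
          refine norm_sum_le_of_le _ fun w hw => ?_
          rw [norm_mul, norm_natCast, norm_pow, norm_div, RCLike.norm_conj, norm_pow, norm_real,
            Real.norm_of_nonneg hR0.le]
          refine mul_le_mul_of_nonneg_left ?_ (Nat.cast_nonneg _)
          have h1 : ‖w‖ / R ^ 2 ≤ 1 / R := by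
            rw [div_le_div_iff₀ (by positivity) hR0]
            nlinarith [((mem_zerosIn hf h0).1 hw).1]
          calc _ ≤ (1 / R) ^ (k + 1) := by gcongr
            _ = 1 / R ^ (k + 1) := by rw [div_pow, one_pow]
            _ ≤ _ := by gcongr
      _ = (∑ w ∈ zerosIn f R, (analyticOrderNatAt f w : ℝ)) * (1 / R ^ 4) := by
          rw [Finset.sum_mul]
      _ ≤ N * R ^ 2 * (1 / R ^ 4) := by gcongr; exact hN R hR
      _ = _ := by field_simp
  have hsplit : iteratedDeriv k (logDeriv f) 0 / k.factorial +
        ∑ w ∈ zerosIn f R, (analyticOrderNatAt f w : ℂ) * w⁻¹ ^ (k + 1) =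
      (iteratedDeriv k (logDeriv f) 0 / k.factorial +
        ∑ w ∈ zerosIn f R, (analyticOrderNatAt f w : ℂ) *
          (w⁻¹ ^ (k + 1) - (conj w / R ^ 2) ^ (k + 1))) +
      ∑ w ∈ zerosIn f R, (analyticOrderNatAt f w : ℂ) * (conj w / R ^ 2) ^ (k + 1) := by
    simp only [mul_sub, Finset.sum_sub_distrib]
    ring
  rw [hsplit, add_div]
  exact (norm_add_le _ _).trans (add_le_add (hest.trans hfirst) hsecond)

end EntireFunction

end

/-! ### The Hausdorff moment problem and analytic continuation -/

section

open Filter Polynomial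
open scoped Topology unitInterval

namespace HausdorffMoment

/-- The linear functional on real polynomials with moments `c`. -/
noncomputable def functional (c : ℕ → ℝ) : ℝ[X] →ₗ[ℝ] ℝ :=
  Polynomial.lsum fun i => c i • LinearMap.id

@[simp]
theorem functional_X_pow (c : ℕ → ℝ) (n : ℕ) : functional c (X ^ n) = c n := by
  rw [functional, Polynomial.lsum_apply, X_pow_eq_monomial, sum_monomial_index] <;> simp

theorem functional_X_pow_mul_one_sub_X_pow (c : ℕ → ℝ) (n k : ℕ) :
    functional c (X ^ n * (1 - X) ^ k) =
      ∑ j ∈ Finset.range (k + 1), (-1) ^ j * (k.choose j : ℝ) * c (n + j) := by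
  have h : (X : ℝ[X]) ^ n * (1 - X) ^ k =
      ∑ j ∈ Finset.range (k + 1), ((-1) ^ j * (k.choose j : ℝ)) • X ^ (n + j) := by
    rw [sub_eq_neg_add, add_pow, Finset.mul_sum]
    refine Finset.sum_congr rfl fun j _ => ?_
    rw [smul_eq_C_mul, neg_pow, pow_add]
    simp only [map_mul, map_pow, map_neg, map_one, map_natCast, one_pow]
    ring
  rw [h, map_sum]
  simp

/-- The weights of the discrete approximations to a solution of the moment problem. -/
noncomputable def weight (c : ℕ → ℝ) (N k : ℕ) : ℝ :=
  functional c (X ^ k * (1 - X) ^ (N - k)) * N.choose k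

/-- The case `n = 0` is the binomial theorem for `X + (1 - X)`. Each further step absorbs a factor
by `(k+1) C(N+1, k+1) = (N+1) C(N, k)`. Falling factorials make the Bernstein identity exact,
whereas ordinary powers would satisfy it only in the limit. -/
theorem sum_descFactorial_mul_bernstein (n N : ℕ) :
    ∑ k ∈ Finset.range (N + 1), ((k.descFactorial n : ℝ) * N.choose k) •
      ((X : ℝ[X]) ^ k * (1 - X) ^ (N - k)) = (N.descFactorial n : ℝ) • X ^ n := by
  induction n generalizing N with
  | zero =>
    have := add_pow (X : ℝ[X]) (1 - X) N
    rw [add_sub_cancel, one_pow] at this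
    simp only [Nat.descFactorial_zero, Nat.cast_one, one_mul, pow_zero, one_smul]
    refine Eq.trans (Finset.sum_congr rfl fun k _ => ?_) this.symm
    rw [smul_eq_C_mul, map_natCast, mul_comm]
  | succ n ih =>
    cases N with
    | zero => simp
    | succ N =>
      rw [Finset.sum_range_succ', Nat.succ_descFactorial_succ]
      simp only [Nat.zero_descFactorial_succ, Nat.cast_zero, zero_mul, zero_smul, add_zero]
      rw [Nat.cast_mul, mul_smul, pow_succ, ← smul_mul_assoc, ← ih N, Finset.sum_mul,
        Finset.smul_sum]
      refine Finset.sum_congr rfl fun k _ => ?_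
      have h := Nat.add_one_mul_choose_eq N k
      have h' : ((N : ℝ) + 1) * N.choose k = (N + 1).choose (k + 1) * ((k : ℝ) + 1) := by
        exact_mod_cast h
      rw [Nat.succ_descFactorial_succ, Nat.succ_sub_succ, smul_mul_assoc, ← mul_smul, pow_succ]
      have e : (((k + 1) * k.descFactorial n : ℕ) : ℝ) * (N + 1).choose (k + 1) =
          ((N + 1 : ℕ) : ℝ) * ((k.descFactorial n : ℝ) * N.choose k) := by
        push_cast
        linear_combination (-(k.descFactorial n : ℝ)) * h'
      rw [e]
      congr 1
      ring

theorem sum_weight_mul_descFactorial (c : ℕ → ℝ) (n N : ℕ) :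
    ∑ k ∈ Finset.range (N + 1), weight c N k * k.descFactorial n = N.descFactorial n * c n := by
  have := congrArg (functional c) (sum_descFactorial_mul_bernstein n N)
  rw [map_sum, map_smul, functional_X_pow, smul_eq_mul] at this
  rw [← this]
  refine Finset.sum_congr rfl fun k _ => ?_
  rw [map_smul, smul_eq_mul, weight]
  ring

/-- The recursion `k^(n+1) - (k)_(n+1) = k (k^n - (k)_n) + n (k)_n` adds at most `n N^(n+1)` at each
step. Thus falling factorials and powers differ by `O(N^(n-1))`, uniformly in `k ≤ N`. -/
theorem mul_pow_sub_descFactorial_le {k N : ℕ} (hk : k ≤ N) (n : ℕ) :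
    (N : ℝ) * ((k : ℝ) ^ n - k.descFactorial n) ≤ (n : ℝ) ^ 2 * N ^ n := by
  induction n with
  | zero => simp
  | succ n ih =>
    have hd : ((k.descFactorial (n + 1) : ℕ) : ℝ) = ((k : ℝ) - n) * k.descFactorial n := by
      rw [Nat.descFactorial_succ]
      rcases le_or_gt n k with h | h
      · push_cast [Nat.cast_sub h]; ring
      · rw [Nat.descFactorial_of_lt h]; simp
    have hk' : (k : ℝ) ≤ N := by exact_mod_cast hk
    have h1 : ((k.descFactorial n : ℕ) : ℝ) ≤ (N : ℝ) ^ n :=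
      (by exact_mod_cast Nat.descFactorial_le_pow k n : ((k.descFactorial n : ℕ) : ℝ) ≤ (k : ℝ) ^ n).trans
        (pow_le_pow_left₀ (Nat.cast_nonneg _) hk' n)
    have h2 : (k : ℝ) * ((N : ℝ) * ((k : ℝ) ^ n - k.descFactorial n)) ≤
        N * ((n : ℝ) ^ 2 * N ^ n) := by
      calc _ ≤ (k : ℝ) * ((n : ℝ) ^ 2 * N ^ n) := by gcongr
        _ ≤ _ := by gcongr
    have h3 : (n : ℝ) * N * k.descFactorial n ≤ n * N * N ^ n := by gcongr
    have h4 : 0 ≤ ((n : ℝ) + 1) * ((N : ℝ) * N ^ n) := by positivity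
    rw [hd]
    push_cast
    rw [pow_succ, pow_succ (N : ℝ)]
    nlinarith

/-- The points at which the discrete approximations are supported. -/
noncomputable def node (N k : ℕ) : I :=
  Set.projIcc 0 1 zero_le_one ((k : ℝ) / N)

theorem coe_node {N k : ℕ} (hk : k ≤ N) : (node N k : ℝ) = k / N := by
  have : (k : ℝ) / N ∈ Set.Icc (0 : ℝ) 1 :=
    ⟨by positivity, div_le_one_of_le₀ (by exact_mod_cast hk) (by positivity)⟩
  rw [node, Set.projIcc_of_mem _ this]

/-- The inclusion of the unit interval into the complex numbers. -/
noncomputable def coord : C(I, ℂ) := ⟨fun t => ((t : ℝ) : ℂ), by fun_prop⟩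

@[simp]
theorem coord_apply (t : I) : coord t = ((t : ℝ) : ℂ) := rfl

/-- The discrete approximations to a solution of the moment problem. -/
noncomputable def approx (c : ℕ → ℝ) (N : ℕ) : StrongDual ℂ C(I, ℂ) :=
  ∑ k ∈ Finset.range (N + 1), (weight c N k : ℂ) • ContinuousMap.evalCLM ℂ (node N k)

theorem approx_apply (c : ℕ → ℝ) (N : ℕ) (h : C(I, ℂ)) :
    approx c N h = ∑ k ∈ Finset.range (N + 1), (weight c N k : ℂ) * h (node N k) := by
  simp [approx]

variable {c : ℕ → ℝ}

theorem sum_weight (N : ℕ) : ∑ k ∈ Finset.range (N + 1), weight c N k = c 0 := by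
  simpa using sum_weight_mul_descFactorial c 0 N

theorem norm_approx_le (hc : ∀ N k, 0 ≤ weight c N k) (N : ℕ) : ‖approx c N‖ ≤ c 0 := by
  have h0 : 0 ≤ c 0 := by
    rw [← sum_weight (c := c) 0]; exact Finset.sum_nonneg fun k _ => hc _ _
  refine ContinuousLinearMap.opNorm_le_bound _ h0 fun h => ?_
  rw [approx_apply, ← sum_weight (c := c) N, Finset.sum_mul]
  refine norm_sum_le_of_le _ fun k _ => ?_
  rw [norm_mul, Complex.norm_real, Real.norm_of_nonneg (hc _ _)]
  exact mul_le_mul_of_nonneg_left (h.norm_coe_le_norm _) (hc _ _)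

/-- The weights have falling-factorial moments exactly `(N)_n c n`. Replacing falling factorials by
powers costs `O(1/N)` after division by `N^n`, because nonnegative weights have total mass `c 0`. -/
theorem tendsto_approx (hc : ∀ N k, 0 ≤ weight c N k) (n : ℕ) :
    Tendsto (fun N => approx c N (coord ^ n)) atTop (𝓝 (c n)) := by
  have hreal : ∀ N, approx c N (coord ^ n) =
      ((∑ k ∈ Finset.range (N + 1), weight c N k * ((k : ℝ) / N) ^ n : ℝ) : ℂ) := by
    intro N
    rw [approx_apply]
    push_cast
    refine Finset.sum_congr rfl fun k hk => ?_
    rw [coord_apply, coe_node (by simpa [Nat.lt_succ_iff] using hk)]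
    push_cast
    rfl
  simp only [hreal]
  refine (Complex.continuous_ofReal.tendsto _).comp ?_
  rw [tendsto_iff_dist_tendsto_zero]
  have hlim : Tendsto (fun N : ℕ => ((n : ℝ) ^ 2 * (c 0 + |c n|)) / (N : ℝ)) atTop (𝓝 0) :=
    tendsto_const_div_atTop_nhds_zero_nat _
  refine squeeze_zero' (Eventually.of_forall fun _ => dist_nonneg) ?_ hlim
  filter_upwards [eventually_gt_atTop 0] with N hN
  have hN' : (0 : ℝ) < N := by exact_mod_cast hN
  have hdiff : ∀ k ≤ N, |(k : ℝ) ^ n - k.descFactorial n| ≤ (n : ℝ) ^ 2 * N ^ n / N := by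
    intro k hk
    have h1 : ((k.descFactorial n : ℕ) : ℝ) ≤ (k : ℝ) ^ n := by
      exact_mod_cast Nat.descFactorial_le_pow k n
    rw [abs_of_nonneg (by linarith), le_div_iff₀ hN', mul_comm]
    exact mul_pow_sub_descFactorial_le hk n
  have hid : (∑ k ∈ Finset.range (N + 1), weight c N k * ((k : ℝ) / N) ^ n) - c n =
      (∑ k ∈ Finset.range (N + 1), weight c N k * ((k : ℝ) ^ n - k.descFactorial n)
        - c n * ((N : ℝ) ^ n - N.descFactorial n)) / (N : ℝ) ^ n := by
    have h1 := sum_weight_mul_descFactorial c n N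
    simp only [mul_sub, Finset.sum_sub_distrib, h1, div_pow, mul_div_assoc', ← Finset.sum_div]
    field_simp
    ring
  have hsum : |∑ k ∈ Finset.range (N + 1), weight c N k * ((k : ℝ) ^ n - k.descFactorial n)| ≤
      c 0 * ((n : ℝ) ^ 2 * N ^ n / N) := by
    rw [← sum_weight (c := c) N, Finset.sum_mul]
    refine (Finset.abs_sum_le_sum_abs _ _).trans (Finset.sum_le_sum fun k hk => ?_)
    rw [abs_mul, abs_of_nonneg (hc _ _)]
    exact mul_le_mul_of_nonneg_left
      (hdiff k (by simpa [Nat.lt_succ_iff] using hk)) (hc _ _)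
  rw [Real.dist_eq, hid, abs_div, abs_of_pos (pow_pos hN' n), div_le_iff₀ (pow_pos hN' n)]
  calc _ ≤ c 0 * ((n : ℝ) ^ 2 * N ^ n / N) + |c n| * ((n : ℝ) ^ 2 * N ^ n / N) := by
        refine (abs_sub _ _).trans (add_le_add hsum ?_)
        rw [abs_mul]
        exact mul_le_mul_of_nonneg_left (hdiff N le_rfl) (abs_nonneg _)
    _ = _ := by ring

/-- **Hausdorff moment problem**: a completely monotone sequence is the moment sequence of a
continuous functional on the continuous functions on the unit interval. -/
theorem exists_functional
    (hc : ∀ n k : ℕ, 0 ≤ ∑ j ∈ Finset.range (k + 1), (-1) ^ j * (k.choose j : ℝ) * c (n + j)) :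
    ∃ Λ : StrongDual ℂ C(I, ℂ), ∀ n, Λ (coord ^ n) = c n := by
  have hw : ∀ N k, 0 ≤ weight c N k := fun N k => by
    rw [weight, functional_X_pow_mul_one_sub_X_pow]
    exact mul_nonneg (hc _ _) (Nat.cast_nonneg _)
  let F : ℕ → WeakDual ℂ C(I, ℂ) := fun N => StrongDual.toWeakDual (approx c N)
  -- Banach–Alaoglu: the approximations stay in a ball of radius `c 0`, so they converge weak-*
  -- along an ultrafilter. The moments converge along the whole sequence, which identifies those of
  -- the limit.
  obtain ⟨Λ, -, hΛ⟩ := (WeakDual.isCompact_closedBall (𝕜 := ℂ) (0 : StrongDual ℂ C(I, ℂ))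
    (c 0)).ultrafilter_le_nhds ((hyperfilter ℕ).map F) (by
      refine tendsto_principal.2 (Eventually.of_forall fun N => ?_)
      simpa [F] using norm_approx_le hw N)
  refine ⟨WeakDual.toStrongDual Λ, fun n => ?_⟩
  have h1 : Tendsto (fun N => F N (coord ^ n)) (hyperfilter ℕ) (𝓝 (Λ (coord ^ n))) :=
    ((WeakDual.eval_continuous (𝕜 := ℂ) (coord ^ n : C(I, ℂ))).tendsto Λ).comp hΛ
  have h2 : Tendsto (fun N => F N (coord ^ n)) (hyperfilter ℕ) (𝓝 (c n)) :=
    (tendsto_approx hw n).mono_left (Nat.hyperfilter_le_atTop)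
  exact tendsto_nhds_unique h1 h2

/-- The generating function of a completely monotone sequence continues analytically to the
complex plane cut along `[1, ∞)`. -/
theorem exists_analytic_continuation
    (hc : ∀ n k : ℕ, 0 ≤ ∑ j ∈ Finset.range (k + 1), (-1) ^ j * (k.choose j : ℝ) * c (n + j)) :
    ∃ Φ : ℂ → ℂ, (∀ w : ℂ, (∀ t ∈ Set.Icc (0 : ℝ) 1, w * t ≠ 1) → DifferentiableAt ℂ Φ w) ∧
      ∀ w : ℂ, ‖w‖ < 1 → HasSum (fun n => (c n : ℂ) * w ^ n) (Φ w) := by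
  obtain ⟨Λ, hΛ⟩ := exists_functional hc
  have hnorm : ‖coord‖ ≤ 1 := by
    rw [ContinuousMap.norm_le _ zero_le_one]
    intro t
    rw [coord_apply, Complex.norm_real, Real.norm_of_nonneg t.2.1]
    exact t.2.2
  -- The resolvent `1/(1 - wt)` in the Banach algebra `C([0,1])` is holomorphic in `w` wherever it
  -- exists, and for `‖w‖ < 1` its Neumann series gives the generating function of the moments.
  refine ⟨fun w => Λ (Ring.inverse (1 - w • coord)), fun w hw => ?_, fun w hw => ?_⟩
  · have hu : IsUnit (1 - w • coord) := by
      rw [ContinuousMap.isUnit_iff_forall_ne_zero]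
      intro t h
      exact hw t t.2 ((sub_eq_zero.1 (by simpa using h)).symm)
    refine Λ.differentiableAt.comp w ?_
    exact DifferentiableAt.comp (g := Ring.inverse) (f := fun w : ℂ => 1 - w • coord) w
      (differentiableAt_inverse (𝕜 := ℂ) hu) (by fun_prop)
  · have hlt : ‖w • coord‖ < 1 := by
      rw [norm_smul]
      nlinarith [norm_nonneg w, norm_nonneg coord]
    have h := (summable_geometric_of_norm_lt_one hlt).hasSum.mapL Λ
    change HasSum _ (Λ (Ring.inverse (1 - w • coord)))
    rw [NormedRing.inverse_one_sub _ hlt]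
    convert! h using 2 with n
    · rw [_root_.smul_pow, map_smul, hΛ, smul_eq_mul, mul_comm]

end HausdorffMoment

end

/-! ### Theta functions of characters and the integral representation of `ξ` -/

section

open Filter MeasureTheory Set HurwitzZeta
open scoped Topology

namespace DirichletCharacter

variable {q : ℕ}

theorem parity_of_even {χ : DirichletCharacter ℂ q} (h : χ.Even) : χ.parity = 0 := by
  simp [parity, h]

theorem parity_of_odd {χ : DirichletCharacter ℂ q} (h : χ.Odd) : χ.parity = 1 := by
  simp [parity, h.not_even]

/-- The kernel of Hurwitz type attached to a residue class, of the parity of the character. -/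
noncomputable def kernel (χ : DirichletCharacter ℂ q) (a : UnitAddCircle) (t : ℝ) : ℝ :=
  if χ.parity = 0 then evenKernel a t else oddKernel a t

theorem kernel_of_even {χ : DirichletCharacter ℂ q} (h : χ.Even) (a : UnitAddCircle) :
    χ.kernel a = evenKernel a := by
  ext t
  simp [kernel, parity_of_even h]

theorem kernel_of_odd {χ : DirichletCharacter ℂ q} (h : χ.Odd) (a : UnitAddCircle) :
    χ.kernel a = oddKernel a := by
  ext t
  simp [kernel, parity_of_odd h]

theorem hasSum_kernel (χ : DirichletCharacter ℂ q) (a : ℝ) {t : ℝ} (ht : 0 < t) :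
    HasSum (fun n : ℤ => ((n : ℝ) + a) ^ χ.parity * Real.exp (-Real.pi * (n + a) ^ 2 * t))
      (χ.kernel a t) := by
  rcases χ.even_or_odd with h | h
  · simpa [kernel, parity_of_even h] using hasSum_int_evenKernel a ht
  · simpa [kernel, parity_of_odd h] using hasSum_int_oddKernel a ht

variable [NeZero q]

/-- The theta function of a Dirichlet character, as a combination of kernels of Hurwitz type. -/
noncomputable def theta (χ : DirichletCharacter ℂ q) (t : ℝ) : ℂ :=
  ∑ j : ZMod q, χ j * (χ.kernel (ZMod.toAddCircle j) t : ℂ)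

/-- Every integer is `q n + j` for exactly one residue `j`, so the sum over integers splits into the
Hurwitz kernels at `j / q`. -/
theorem hasSum_theta (χ : DirichletCharacter ℂ q) {t : ℝ} (ht : 0 < t) :
    HasSum (fun m : ℤ => χ (m : ZMod q) *
      ((((m : ℝ) / q) ^ χ.parity * Real.exp (-Real.pi * (m / q) ^ 2 * t) : ℝ) : ℂ))
      (χ.theta t) := by
  have hq0 : (q : ℝ) ≠ 0 := Nat.cast_ne_zero.2 (NeZero.ne q)
  set g : ℤ → ℝ := fun m => ((m : ℝ) / q) ^ χ.parity * Real.exp (-Real.pi * (m / q) ^ 2 * t)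
  have key : ∀ j : ZMod q, HasSum
      (fun m : ℤ => if (m : ZMod q) = j then χ (m : ZMod q) * (g m : ℂ) else 0)
      (χ j * (χ.kernel (ZMod.toAddCircle j) t : ℂ)) := by
    intro j
    have hinj : Function.Injective (fun n : ℤ => (q : ℤ) * n + j.val) := by
      intro a b hab
      have : (q : ℤ) * a = q * b := by simpa using hab
      exact mul_left_cancel₀ (by exact_mod_cast NeZero.ne q) this
    rw [← hinj.hasSum_iff]
    · have h1 := (Complex.hasSum_ofReal.2 (χ.hasSum_kernel ((j.val : ℝ) / q) ht)).mul_left (χ j)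
      rw [ZMod.toAddCircle_apply]
      refine h1.congr_fun fun n => ?_
      have h2 : (((q : ℤ) * n + j.val : ℤ) : ZMod q) = j := by simp
      have h3 : (((q : ℤ) * n + j.val : ℤ) : ℝ) / q = n + (j.val : ℝ) / q := by
        push_cast
        field_simp
      simp only [Function.comp_apply, h2, if_true, g, h3]
    · intro m hm
      rw [if_neg]
      rintro rfl
      refine hm ⟨m / q, ?_⟩
      simp only [ZMod.val_intCast]
      exact Int.mul_ediv_add_emod m q
  have := hasSum_sum (s := Finset.univ) fun j _ => key j
  simp only [Finset.sum_ite_eq, Finset.mem_univ, if_true] at this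
  exact this

theorem theta_eq_tsum (hq : 1 < q) (χ : DirichletCharacter ℂ q) {t : ℝ} (ht : 0 < t) :
    (q : ℂ) ^ χ.parity * χ.theta t = 2 * ∑' n : ℕ+, ((n : ℕ) : ℂ) ^ χ.parity *
      χ ((n : ℕ) : ZMod q) * (Real.exp (-Real.pi * ((n : ℕ) / q) ^ 2 * t) : ℂ) := by
  have hq0 : (q : ℂ) ≠ 0 := Nat.cast_ne_zero.2 (NeZero.ne q)
  have : Nontrivial (ZMod q) := ZMod.nontrivial_iff.2 hq.ne'
  have h := (χ.hasSum_theta ht).nat_add_neg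
  simp only [Int.cast_zero, MulChar.map_zero, zero_mul, add_zero] at h
  set F : ℕ → ℂ := fun n => 2 * ((n : ℂ) ^ χ.parity * χ (n : ZMod q) *
    (Real.exp (-Real.pi * (n / q) ^ 2 * t) : ℂ)) with hF
  have h' : HasSum F ((q : ℂ) ^ χ.parity * χ.theta t) := by
    refine (h.mul_left ((q : ℂ) ^ χ.parity)).congr_fun fun n => ?_
    -- The parity exponent is chosen so that `n` and `-n` contribute equally, whence the factor `2`.
    have hneg : χ (-(n : ZMod q)) * (-1 : ℂ) ^ χ.parity = χ (n : ZMod q) := by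
      rcases χ.even_or_odd with he | ho
      · simp [parity_of_even he, he.eval_neg]
      · simp [parity_of_odd ho, ho.eval_neg]
    have e1 : ((-(n : ℤ) : ℤ) : ZMod q) = -(n : ZMod q) := by simp
    have e2 : (((-(n : ℤ) : ℤ) : ℝ) / q) = -((n : ℝ) / q) := by push_cast; ring
    rw [e1, e2, neg_sq, neg_pow ((n : ℝ) / q)]
    have e3 : (q : ℂ) ^ χ.parity * (((n : ℝ) / q : ℝ) : ℂ) ^ χ.parity = (n : ℂ) ^ χ.parity := by
      rw [← mul_pow]
      push_cast
      field_simp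
    simp only [hF, Int.cast_natCast]
    rw [← e3]
    push_cast
    rw [← hneg]
    ring
  have hsupp : Function.Injective ((↑) : ℕ+ → ℕ) := PNat.coe_injective
  rw [← hsupp.hasSum_iff] at h'
  · rw [← h'.tsum_eq, ← tsum_mul_left]
    rfl
  · intro n hn
    have : n = 0 := by
      by_contra h0
      exact hn ⟨⟨n, Nat.pos_of_ne_zero h0⟩, rfl⟩
    simp [hF, this, MulChar.map_zero χ]

theorem phi_eq_theta (hq : 1 < q) (χ : DirichletCharacter ℂ q) (y : ℝ) :
    χ.phi y = (q : ℂ) ^ χ.parity * χ.theta (q * Real.exp (2 * y)) *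
      (Real.exp (((χ.parity : ℝ) + 1 / 2) * y) : ℂ) := by
  have hq0 : (q : ℝ) ≠ 0 := Nat.cast_ne_zero.2 (NeZero.ne q)
  rw [theta_eq_tsum hq χ (by positivity), phi, mul_assoc, ← tsum_mul_right]
  congr 1
  refine tsum_congr fun n => ?_
  rw [mul_assoc _ (Complex.ofReal _), ← Complex.ofReal_mul, ← Real.exp_add]
  congr 4
  field_simp

theorem continuousOn_theta (χ : DirichletCharacter ℂ q) : ContinuousOn χ.theta (Ioi 0) := by
  refine continuousOn_finsetSum _ fun j _ => continuousOn_const.mul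
    (Complex.continuous_ofReal.comp_continuousOn ?_)
  rcases χ.even_or_odd with h | h
  · exact kernel_of_even h _ ▸ continuousOn_evenKernel _
  · exact kernel_of_odd h _ ▸ continuousOn_oddKernel _

/-- Exponential decay at infinity. -/
def ExpDecay (g : ℝ → ℂ) : Prop :=
  ∃ p : ℝ, 0 < p ∧ g =O[atTop] fun x => Real.exp (-p * x)

theorem ExpDecay.sum {ι : Type*} (s : Finset ι) (c : ι → ℂ) (g : ι → ℝ → ℂ)
    (h : ∀ i, ExpDecay (g i)) : ExpDecay fun t => ∑ i ∈ s, c i * g i t := by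
  classical
  induction s using Finset.induction_on with
  | empty => exact ⟨1, one_pos, by simpa using Asymptotics.isBigO_zero _ _⟩
  | insert a s ha ih =>
    obtain ⟨p, hp, hp'⟩ := ih
    obtain ⟨r, hr, hr'⟩ := h a
    have mono : ∀ x : ℝ, min p r ≤ x →
        (fun y => Real.exp (-x * y)) =O[atTop] fun y => Real.exp (-min p r * y) := by
      intro x hx
      refine Asymptotics.IsBigO.of_bound 1 ?_
      filter_upwards [eventually_ge_atTop 0] with y hy
      rw [Real.norm_of_nonneg (Real.exp_pos _).le, Real.norm_of_nonneg (Real.exp_pos _).le,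
        one_mul, Real.exp_le_exp]
      nlinarith
    refine ⟨min p r, lt_min hp hr, ?_⟩
    simp only [Finset.sum_insert ha]
    exact ((hr'.trans (mono r (min_le_right _ _))).const_mul_left _).add
      (hp'.trans (mono p (min_le_left _ _)))

theorem expDecay_ofReal {g : ℝ → ℝ}
    (h : ∃ p : ℝ, 0 < p ∧ g =O[atTop] fun x => Real.exp (-p * x)) :
    ExpDecay fun t => (g t : ℂ) := by
  obtain ⟨p, hp, h⟩ := h
  exact ⟨p, hp, Complex.isBigO_ofReal_left.2 h⟩

/-- Only the even kernel at residue `0` has a constant term at infinity, and `χ 0 = 0` removes it.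
-/
theorem expDecay_theta (hq : 1 < q) (χ : DirichletCharacter ℂ q) : ExpDecay χ.theta := by
  have : Nontrivial (ZMod q) := ZMod.nontrivial_iff.2 hq.ne'
  rcases χ.even_or_odd with h | h
  · have h1 := ExpDecay.sum Finset.univ χ (fun j t => ((evenKernel (ZMod.toAddCircle j) t -
      (if ZMod.toAddCircle j = 0 then 1 else 0) : ℝ) : ℂ))
      fun j => expDecay_ofReal (isBigO_atTop_evenKernel_sub _)
    convert! h1 using 2 with t
    refine Finset.sum_congr rfl fun j _ => ?_
    by_cases hj : j = 0
    · simp [hj, MulChar.map_zero χ]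
    · simp [kernel, parity_of_even h, hj]
  · have h1 := ExpDecay.sum Finset.univ χ (fun j t => (oddKernel (ZMod.toAddCircle j) t : ℂ))
      fun j => expDecay_ofReal (isBigO_atTop_oddKernel _)
    have h2 : χ.theta = fun t => ∑ j, χ j * (oddKernel (ZMod.toAddCircle j) t : ℂ) := by
      ext t
      simp [theta, kernel_of_odd h]
    exact h2 ▸ h1

/-- The functional equations of the Hurwitz kernels turn behaviour at `0` into behaviour at infinity
of cosine or sine kernels. Every cosine kernel has constant term `1`, and these cancel because the
values of a nontrivial character sum to zero. -/
theorem exists_theta_eq {χ : DirichletCharacter ℂ q} (hχ : χ ≠ 1) :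
    ∃ g : ℝ → ℂ, ExpDecay g ∧
      ∀ t : ℝ, 0 < t → χ.theta t = ((1 / t ^ ((χ.parity : ℝ) + 1 / 2) : ℝ) : ℂ) * g (1 / t) := by
  rcases χ.even_or_odd with h | h
  · refine ⟨_, ExpDecay.sum Finset.univ χ (fun j t => ((cosKernel (ZMod.toAddCircle j) t - 1 : ℝ) : ℂ))
      fun j => expDecay_ofReal (isBigO_atTop_cosKernel_sub _), fun t ht => ?_⟩
    have hsum : ∑ j : ZMod q, χ j = 0 := χ.sum_eq_zero_of_ne_one hχ
    simp only [theta, kernel, parity_of_even h, if_true, evenKernel_functional_equation _ t]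
    push_cast
    simp only [mul_sub, mul_one, Finset.sum_sub_distrib, hsum, sub_zero, Finset.mul_sum]
    refine Finset.sum_congr rfl fun j _ => ?_
    norm_num
    ring
  · refine ⟨_, ExpDecay.sum Finset.univ χ (fun j t => (sinKernel (ZMod.toAddCircle j) t : ℂ))
      fun j => expDecay_ofReal (isBigO_atTop_sinKernel _), fun t ht => ?_⟩
    simp only [theta, kernel, parity_of_odd h, one_ne_zero, if_false,
      oddKernel_functional_equation _ t, Finset.mul_sum]
    refine Finset.sum_congr rfl fun j _ => ?_
    norm_num
    ring

/-- In the even case the individual Hurwitz zeta functions have polar terms, and their kernels must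
be modified before taking Mellin transforms. In the combination weighted by `χ` all corrections
cancel, by `χ 0 = 0` for `t > 1` and by the vanishing of the character sum for `t < 1`. The odd
kernels need no correction. -/
theorem completedLFunction_eq_mellin (hq : 1 < q) {χ : DirichletCharacter ℂ q} (hχ : χ ≠ 1)
    (s : ℂ) : completedLFunction χ s =
      (q : ℂ) ^ (-s) * (mellin χ.theta ((s + χ.parity) / 2) / 2) := by
  have : Nontrivial (ZMod q) := ZMod.nontrivial_iff.2 hq.ne'
  have hsum : ∑ j : ZMod q, χ j = 0 := χ.sum_eq_zero_of_ne_one hχ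
  have hmel : ∀ (z : ℂ) (g : ZMod q → ℝ → ℂ), (∀ j, MellinConvergent (g j) z) →
      mellin (fun t => ∑ j, χ j * g j t) z = ∑ j, χ j * mellin (g j) z := by
    intro z g hg
    simp only [mellin, smul_eq_mul, Finset.mul_sum]
    rw [integral_finsetSum]
    · refine Finset.sum_congr rfl fun j _ => ?_
      rw [← integral_const_mul]
      exact integral_congr_ae (Eventually.of_forall fun t => by ring)
    · intro j _
      have := (hg j).const_mul (χ j)
      refine this.congr (Eventually.of_forall fun t => ?_)
      simp only [smul_eq_mul]
      ring
  rcases χ.even_or_odd with h | h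
  · rw [completedLFunction, ZMod.completedLFunction_def_even h.to_fun]
    congr 1
    have hΛ : ∀ j : ZMod q, χ j * completedHurwitzZetaEven (ZMod.toAddCircle j) s =
        (χ j * (hurwitzEvenFEPair (ZMod.toAddCircle j)).Λ₀ (s / 2) - χ j * (1 / (1 - s)) * 2) / 2 := by
      intro j
      rw [completedHurwitzZetaEven_eq, completedHurwitzZetaEven₀]
      by_cases hj : j = 0
      · simp [hj, MulChar.map_zero χ]
      · rw [if_neg (by simpa using hj)]
        ring
    simp only [hΛ, ← Finset.sum_div, Finset.sum_sub_distrib, ← Finset.sum_mul, hsum, zero_mul,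
      sub_zero, parity_of_even h, Nat.cast_zero, add_zero]
    congr 1
    have := hmel (s / 2) (fun j => (hurwitzEvenFEPair (ZMod.toAddCircle j)).f_modif) fun j =>
      ((hurwitzEvenFEPair (ZMod.toAddCircle j)).isStrongFEPair_toStrongFEPair.hasMellin (s / 2)).1
    simp only [WeakFEPair.Λ₀]
    rw [← this]
    refine setIntegral_congr_ae measurableSet_Ioi ?_
    filter_upwards [compl_mem_ae_iff.mpr (measure_singleton (μ := volume) (1 : ℝ))] with t ht1 ht
    congr 1
    have ht0 : (0 : ℝ) < t := ht
    have ht1 : t ≠ 1 := ht1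
    rcases lt_or_gt_of_ne ht1 with hlt | hgt
    · have : ∀ j : ZMod q, (hurwitzEvenFEPair (ZMod.toAddCircle j)).f_modif t =
          (evenKernel (ZMod.toAddCircle j) t : ℂ) - ((t ^ (-(1 / 2) : ℝ) : ℝ) : ℂ) := by
        intro j
        simp [WeakFEPair.f_modif, hlt, hlt.le, ht0, hurwitzEvenFEPair]
      simp only [this, mul_sub, Finset.sum_sub_distrib, ← Finset.sum_mul, hsum, zero_mul, sub_zero]
      simp [theta, kernel, parity_of_even h]
    · have : ∀ j : ZMod q, χ j * (hurwitzEvenFEPair (ZMod.toAddCircle j)).f_modif t =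
          χ j * (evenKernel (ZMod.toAddCircle j) t : ℂ) := by
        intro j
        by_cases hj : j = 0
        · simp [hj, MulChar.map_zero χ]
        · simp [WeakFEPair.f_modif, hgt, hgt.le, hurwitzEvenFEPair, hj]
      simp [this, theta, kernel, parity_of_even h]
  · rw [completedLFunction, ZMod.completedLFunction_def_odd h.to_fun]
    congr 1
    simp only [completedHurwitzZetaOdd, parity_of_odd h, Nat.cast_one, mul_div_assoc',
      ← Finset.sum_div]
    congr 1
    have hm := fun j : ZMod q =>
      (isStrong_hurwitzOddFEPair (ZMod.toAddCircle j)).hasMellin ((s + 1) / 2)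
    have := hmel ((s + 1) / 2) (fun j => (hurwitzOddFEPair (ZMod.toAddCircle j)).f)
      fun j => (hm j).1
    simp only [fun j => (hm j).2] at this
    rw [← this]
    congr 1
    ext t
    simp [theta, kernel, parity_of_odd h, hurwitzOddFEPair]

/-- This is the Mellin transform of the theta function after the substitution `t = q e^(2y)`. -/
theorem xi_eq_integral (hq : 1 < q) {χ : DirichletCharacter ℂ q} (hχ : χ ≠ 1) (s : ℂ) :
    χ.xi (1 / 2 + Complex.I * s) = ∫ y : ℝ, χ.phi y * Complex.exp (Complex.I * s * y) := by
  have hq0 : (0 : ℝ) < q := Nat.cast_pos.2 (NeZero.pos q)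
  have hqC : (q : ℂ) ≠ 0 := Nat.cast_ne_zero.2 (NeZero.ne q)
  set z : ℂ := (1 / 2 + Complex.I * s + χ.parity) / 2 with hz
  have himg : (fun y : ℝ => (q : ℝ) * Real.exp (2 * y)) '' univ = Ioi 0 := by
    ext t
    simp only [image_univ, mem_range, mem_Ioi]
    constructor
    · rintro ⟨y, rfl⟩; positivity
    · intro ht
      refine ⟨Real.log (t / q) / 2, ?_⟩
      rw [mul_div_cancel₀ _ two_ne_zero, Real.exp_log (by positivity)]
      field_simp
  have hsub := integral_image_eq_integral_abs_deriv_smul (s := univ)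
    (f := fun y : ℝ => (q : ℝ) * Real.exp (2 * y)) (f' := fun y => q * (Real.exp (2 * y) * (2 * 1)))
    MeasurableSet.univ
    (fun y _ => ((((hasDerivAt_id y).const_mul 2).exp).const_mul (q : ℝ)).hasDerivWithinAt)
    (fun a _ b _ hab => by
      have := mul_left_cancel₀ hq0.ne' hab
      linarith [Real.exp_injective this])
    (fun t : ℝ => (t : ℂ) ^ (z - 1) • χ.theta t)
  rw [himg, setIntegral_univ] at hsub
  rw [xi, completedLFunction_eq_mellin hq hχ, mellin, hsub, ← integral_div, ← integral_const_mul,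
    ← integral_const_mul]
  refine integral_congr_ae (Eventually.of_forall fun y => ?_)
  simp only
  rw [phi_eq_theta hq χ y]
  set T : ℝ := (q : ℝ) * Real.exp (2 * y) with hT
  have hTpos : 0 < T := by positivity
  have hTC : (T : ℂ) ≠ 0 := Complex.ofReal_ne_zero.2 hTpos.ne'
  have hpow : (T : ℂ) * (T : ℂ) ^ (z - 1) = (q : ℂ) ^ z * Complex.exp (2 * y * z) := by
    have h1 : (T : ℂ) ^ z = ((q : ℝ) : ℂ) ^ z * ((Real.exp (2 * y) : ℝ) : ℂ) ^ z := by
      rw [hT, Complex.ofReal_mul, Complex.mul_cpow_ofReal_nonneg hq0.le (Real.exp_pos _).le]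
    rw [Complex.cpow_sub _ _ hTC, Complex.cpow_one, mul_div_cancel₀ _ hTC, h1,
      Complex.cpow_def_of_ne_zero (x := ((Real.exp (2 * y) : ℝ) : ℂ))
        (Complex.ofReal_ne_zero.2 (Real.exp_pos _).ne'), ← Complex.ofReal_log (Real.exp_pos _).le,
      Real.log_exp]
    push_cast
    rfl
  have habs : |(q : ℝ) * (Real.exp (2 * y) * (2 * 1))| = 2 * T := by
    rw [abs_of_pos (by positivity), hT]; ring
  have hexp : Complex.exp (2 * y * z) =
      (Real.exp (((χ.parity : ℝ) + 1 / 2) * y) : ℂ) * Complex.exp (Complex.I * s * y) := by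
    push_cast
    rw [← Complex.exp_add, hz]
    congr 1
    ring
  have hqpow : (q : ℂ) ^ z * ((q : ℂ) ^ (-(1 / 2 + Complex.I * s)) * (q : ℂ) ^ z) =
      (q : ℂ) ^ χ.parity := by
    rw [← Complex.cpow_add _ _ hqC, ← Complex.cpow_add _ _ hqC, ← Complex.cpow_natCast]
    congr 1
    rw [hz]
    ring
  rw [habs, smul_eq_mul, Complex.real_smul]
  push_cast at hexp ⊢
  linear_combination ((q : ℂ) ^ z * (q : ℂ) ^ (-(1 / 2 + Complex.I * s)) * χ.theta T) * hpow +
    ((q : ℂ) ^ z * (q : ℂ) ^ (-(1 / 2 + Complex.I * s)) * χ.theta T * (q : ℂ) ^ z) * hexp +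
    (χ.theta T * Complex.exp (((χ.parity : ℂ) + 1 / 2) * y) * Complex.exp (Complex.I * s * y)) * hqpow

end DirichletCharacter

end

/-! ### Decay of `φ`, growth of `ξ`, and the functional equation -/

section

open Filter MeasureTheory Set
open scoped Topology

namespace DirichletCharacter

theorem isBigO_exp_neg_exp {p : ℝ} (hp : 0 < p) (a A : ℝ) :
    (fun y : ℝ => Real.exp (-p * Real.exp (2 * y) + a * y) * Real.exp (A * y ^ 2)) =O[atTop]
      fun y => Real.exp (-1 * y) := by
  have h1 := (isLittleO_pow_exp_pos_mul_atTop 1 (b := 2) two_pos).const_mul_left (a + 1)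
  have h2 := (isLittleO_pow_exp_pos_mul_atTop 2 (b := 2) two_pos).const_mul_left A
  refine Asymptotics.IsBigO.of_bound 1 ?_
  filter_upwards [(h1.add h2).def hp] with y hy
  rw [Real.norm_eq_abs, Real.norm_of_nonneg (Real.exp_pos _).le] at hy
  have := (le_abs_self _).trans hy
  rw [← Real.exp_add, Real.norm_of_nonneg (Real.exp_pos _).le,
    Real.norm_of_nonneg (Real.exp_pos _).le, one_mul, Real.exp_le_exp]
  linarith

variable {q : ℕ}

theorem mul_abs_le_sq {ε : ℝ} (hε : 0 < ε) (a y : ℝ) :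
    a * |y| ≤ ε * a ^ 2 + 1 / (4 * ε) * y ^ 2 := by
  have h : ε * a ^ 2 + 1 / (4 * ε) * y ^ 2 - a * |y| = ε * (a - |y| / (2 * ε)) ^ 2 := by
    rw [← sq_abs y]
    field_simp
    ring
  have : 0 ≤ ε * (a - |y| / (2 * ε)) ^ 2 := by positivity
  linarith

/-- With `a = ‖s‖` this is the source of the growth bound `exp(ε‖s‖²)` for `ξ`: the linear exponent
splits into `ε a²` and a Gaussian in `y`, and the decay of `φ` beats any Gaussian. -/
theorem norm_phi_mul_exp_le (χ : DirichletCharacter ℂ q) {ε : ℝ} (hε : 0 < ε) (a y : ℝ) :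
    ‖χ.phi y‖ * Real.exp (a * |y|) ≤
      Real.exp (ε * a ^ 2) * (‖χ.phi y‖ * Real.exp (1 / (4 * ε) * y ^ 2)) := by
  rw [mul_left_comm, ← Real.exp_add]
  exact mul_le_mul_of_nonneg_left (Real.exp_le_exp.2 (mul_abs_le_sq hε a y)) (norm_nonneg _)

theorem parity_inv (χ : DirichletCharacter ℂ q) : χ⁻¹.parity = χ.parity := by
  rcases χ.even_or_odd with h | h
  · have : χ⁻¹.Even := by
      rw [DirichletCharacter.Even, MulChar.inv_apply_eq_inv', h, inv_one]
    rw [parity_of_even h, parity_of_even this]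
  · have : χ⁻¹.Odd := by
      rw [DirichletCharacter.Odd, MulChar.inv_apply_eq_inv', h, inv_neg, inv_one]
    rw [parity_of_odd h, parity_of_odd this]

variable [NeZero q]

theorem continuous_phi (hq : 1 < q) (χ : DirichletCharacter ℂ q) : Continuous χ.phi := by
  have hq0 : (0 : ℝ) < q := Nat.cast_pos.2 (NeZero.pos q)
  rw [funext (phi_eq_theta hq χ)]
  refine (continuous_const.mul ?_).mul (by fun_prop)
  exact χ.continuousOn_theta.comp_continuous (by fun_prop) fun y =>
    mul_pos hq0 (Real.exp_pos _)

theorem exists_isBigO_phi_atTop (hq : 1 < q) (χ : DirichletCharacter ℂ q) :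
    ∃ p : ℝ, 0 < p ∧ χ.phi =O[atTop] fun y =>
      Real.exp (-p * Real.exp (2 * y) + ((χ.parity : ℝ) + 1 / 2) * y) := by
  have hq0 : (0 : ℝ) < q := Nat.cast_pos.2 (NeZero.pos q)
  obtain ⟨p, hp, h⟩ := expDecay_theta hq χ
  have htend : Tendsto (fun y : ℝ => (q : ℝ) * Real.exp (2 * y)) atTop atTop :=
    (Real.tendsto_exp_atTop.comp (tendsto_id.const_mul_atTop two_pos)).const_mul_atTop hq0
  obtain ⟨C, hC⟩ := (h.comp_tendsto htend).bound
  refine ⟨p * q, by positivity, Asymptotics.IsBigO.of_bound (‖(q : ℂ) ^ χ.parity‖ * C) ?_⟩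
  filter_upwards [hC] with y hy
  simp only [Function.comp_apply, Real.norm_of_nonneg (Real.exp_pos _).le] at hy
  rw [phi_eq_theta hq χ, norm_mul, norm_mul, Complex.norm_real,
    Real.norm_of_nonneg (Real.exp_pos _).le, Real.norm_of_nonneg (Real.exp_pos _).le, Real.exp_add,
    show -(p * q) * Real.exp (2 * y) = -p * (q * Real.exp (2 * y)) by ring]
  calc _ ≤ ‖(q : ℂ) ^ χ.parity‖ * (C * Real.exp (-p * (q * Real.exp (2 * y)))) *
        Real.exp (((χ.parity : ℝ) + 1 / 2) * y) := by gcongr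
    _ = _ := by ring

theorem exists_isBigO_phi_neg_atTop (hq : 1 < q) {χ : DirichletCharacter ℂ q} (hχ : χ ≠ 1) :
    ∃ p : ℝ, 0 < p ∧ (fun y => χ.phi (-y)) =O[atTop] fun y =>
      Real.exp (-p * Real.exp (2 * y) + ((χ.parity : ℝ) + 1 / 2) * y) := by
  have hq0 : (0 : ℝ) < q := Nat.cast_pos.2 (NeZero.pos q)
  obtain ⟨g, ⟨p, hp, h⟩, hg⟩ := exists_theta_eq hχ
  have htend : Tendsto (fun y : ℝ => (q : ℝ)⁻¹ * Real.exp (2 * y)) atTop atTop :=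
    (Real.tendsto_exp_atTop.comp (tendsto_id.const_mul_atTop two_pos)).const_mul_atTop
      (inv_pos.2 hq0)
  obtain ⟨C, hC⟩ := (h.comp_tendsto htend).bound
  set k : ℝ := (χ.parity : ℝ) + 1 / 2 with hk
  refine ⟨p * (q : ℝ)⁻¹, by positivity,
    Asymptotics.IsBigO.of_bound (‖(q : ℂ) ^ χ.parity‖ * (1 / (q : ℝ) ^ k) * C) ?_⟩
  filter_upwards [hC] with y hy
  simp only [Function.comp_apply, Real.norm_of_nonneg (Real.exp_pos _).le] at hy
  have hinv : 1 / ((q : ℝ) * Real.exp (2 * -y)) = (q : ℝ)⁻¹ * Real.exp (2 * y) := by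
    rw [mul_neg, Real.exp_neg]
    field_simp
  have hpow : 1 / ((q : ℝ) * Real.exp (2 * -y)) ^ k * Real.exp (k * -y) =
      1 / (q : ℝ) ^ k * Real.exp (k * y) := by
    rw [Real.mul_rpow hq0.le (Real.exp_pos _).le, ← Real.exp_mul, ← div_div, div_mul_eq_mul_div,
      div_eq_iff (Real.exp_pos _).ne', mul_assoc (1 / (q : ℝ) ^ k), ← Real.exp_add]
    congr 2
    ring
  rw [phi_eq_theta hq χ, hg _ (by positivity), hinv, ← hk, norm_mul, norm_mul, norm_mul,
    Complex.norm_real, Complex.norm_real, Real.norm_of_nonneg (Real.exp_pos _).le,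
    Real.norm_of_nonneg (Real.exp_pos _).le, Real.norm_of_nonneg (by positivity), Real.exp_add]
  calc _ = ‖(q : ℂ) ^ χ.parity‖ * (1 / ((q : ℝ) * Real.exp (2 * -y)) ^ k * Real.exp (k * -y)) *
        ‖g ((q : ℝ)⁻¹ * Real.exp (2 * y))‖ := by ring
    _ ≤ ‖(q : ℂ) ^ χ.parity‖ * (1 / (q : ℝ) ^ k * Real.exp (k * y)) *
        (C * Real.exp (-p * ((q : ℝ)⁻¹ * Real.exp (2 * y)))) := by
      rw [hpow]; gcongr
    _ = _ := by
      rw [show -(p * (q : ℝ)⁻¹) * Real.exp (2 * y) = -p * ((q : ℝ)⁻¹ * Real.exp (2 * y)) by ring]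
      ring

theorem integrable_phi_mul_exp_sq (hq : 1 < q) {χ : DirichletCharacter ℂ q} (hχ : χ ≠ 1) (A : ℝ) :
    Integrable fun y : ℝ => ‖χ.phi y‖ * Real.exp (A * y ^ 2) := by
  have hcont : Continuous fun y : ℝ => ‖χ.phi y‖ * Real.exp (A * y ^ 2) :=
    (continuous_phi hq χ).norm.mul (by fun_prop)
  obtain ⟨p, hp, h⟩ := exists_isBigO_phi_atTop hq χ
  obtain ⟨r, hr, h'⟩ := exists_isBigO_phi_neg_atTop hq hχ
  have hexp : IntegrableOn (fun y : ℝ => Real.exp (-1 * y)) (Ioi 0) :=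
    exp_neg_integrableOn_Ioi 0 one_pos
  have top := ((h.norm_left.mul (Asymptotics.isBigO_refl
    (fun y : ℝ => Real.exp (A * y ^ 2)) atTop))).trans (isBigO_exp_neg_exp hp _ A)
  have bot := ((h'.norm_left.mul (Asymptotics.isBigO_refl
    (fun y : ℝ => Real.exp (A * y ^ 2)) atTop))).trans (isBigO_exp_neg_exp hr _ A)
  have i1 : IntegrableOn (fun y : ℝ => ‖χ.phi y‖ * Real.exp (A * y ^ 2)) (Ioi 0) :=
    integrable_of_isBigO_exp_neg one_pos hcont.continuousOn top
  have i2 : IntegrableOn (fun y : ℝ => ‖χ.phi (-y)‖ * Real.exp (A * y ^ 2)) (Ioi 0) :=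
    integrable_of_isBigO_exp_neg one_pos
      (((continuous_phi hq χ).comp continuous_neg).norm.mul (by fun_prop)).continuousOn bot
  have i3 : IntegrableOn (fun y : ℝ => ‖χ.phi y‖ * Real.exp (A * y ^ 2)) (Iio 0) := by
    have := i2.comp_neg
    simpa using this
  rw [← integrableOn_univ, ← Iic_union_Ioi (a := (0 : ℝ)), integrableOn_union]
  exact ⟨(integrableOn_Iic_iff_integrableOn_Iio (by simp)).2 i3, i1⟩

theorem integrable_phi_mul_exp_abs (hq : 1 < q) {χ : DirichletCharacter ℂ q} (hχ : χ ≠ 1) (a : ℝ) :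
    Integrable fun y : ℝ => ‖χ.phi y‖ * Real.exp (a * |y|) := by
  refine ((integrable_phi_mul_exp_sq hq hχ (1 / (4 * 1))).const_mul (Real.exp (1 * a ^ 2))).mono'
    ((continuous_phi hq χ).norm.mul (by fun_prop)).aestronglyMeasurable
    (Eventually.of_forall fun y => ?_)
  rw [Real.norm_of_nonneg (by positivity)]
  exact χ.norm_phi_mul_exp_le one_pos a y

/-- The power series of `ξ(1/2 + is, χ)`. -/
theorem hasSum_xi (hq : 1 < q) {χ : DirichletCharacter ℂ q} (hχ : χ ≠ 1) (s : ℂ) :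
    HasSum (fun n : ℕ => Complex.I ^ n * χ.aCoeff n * s ^ n) (χ.xi (1 / 2 + Complex.I * s)) := by
  have hmain := hasSum_integral_of_dominated_convergence (μ := volume)
    (F := fun (n : ℕ) (y : ℝ) => χ.phi y * ((Complex.I * s * y) ^ n / (n.factorial : ℂ)))
    (f := fun y : ℝ => χ.phi y * Complex.exp (Complex.I * s * y))
    (fun n y => ‖χ.phi y‖ * ((‖s‖ * |y|) ^ n / (n.factorial : ℝ)))
    (fun n => ((continuous_phi hq χ).mul (by fun_prop)).aestronglyMeasurable)
    (fun n => Eventually.of_forall fun y => ?_) (Eventually.of_forall fun y => ?_) ?_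
    (Eventually.of_forall fun y => ?_)
  · rw [xi_eq_integral hq hχ]
    refine hmain.congr_fun fun n => ?_
    rw [aCoeff, ← mul_assoc, ← integral_const_mul, mul_comm _ (s ^ n), ← integral_const_mul]
    refine integral_congr_ae (Eventually.of_forall fun y => ?_)
    simp only
    rw [mul_pow, mul_pow]
    ring
  · simp
  · exact (Real.summable_pow_div_factorial _).mul_left _
  · simp only [tsum_mul_left]
    refine (integrable_phi_mul_exp_abs hq hχ ‖s‖).congr (Eventually.of_forall fun y => ?_)
    simp only
    rw [Real.exp_eq_exp_ℝ, NormedSpace.exp_eq_tsum_div]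
  · refine HasSum.mul_left _ ?_
    rw [Complex.exp_eq_exp_ℂ]
    exact NormedSpace.expSeries_div_hasSum_exp _

theorem exists_norm_xi_le (hq : 1 < q) {χ : DirichletCharacter ℂ q} (hχ : χ ≠ 1) {ε : ℝ}
    (hε : 0 < ε) :
    ∃ C : ℝ, 0 ≤ C ∧ ∀ s, ‖χ.xi (1 / 2 + Complex.I * s)‖ ≤ C * Real.exp (ε * ‖s‖ ^ 2) := by
  refine ⟨∫ y : ℝ, ‖χ.phi y‖ * Real.exp (1 / (4 * ε) * y ^ 2),
    integral_nonneg fun y => by positivity, fun s => ?_⟩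
  rw [xi_eq_integral hq hχ, mul_comm _ (Real.exp _), ← integral_const_mul]
  refine norm_integral_le_of_norm_le ((integrable_phi_mul_exp_sq hq hχ _).const_mul _)
    (Eventually.of_forall fun y => le_trans ?_ (χ.norm_phi_mul_exp_le hε ‖s‖ y))
  rw [norm_mul, Complex.norm_exp]
  refine mul_le_mul_of_nonneg_left (Real.exp_le_exp.2 ?_) (norm_nonneg _)
  refine (Complex.re_le_norm _).trans (le_of_eq ?_)
  simp

theorem ne_one_of_isPrimitive (hq : 1 < q) {χ : DirichletCharacter ℂ q} (hχ : χ.IsPrimitive) :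
    χ ≠ 1 := by
  rintro rfl
  rw [isPrimitive_def, conductor_one] at hχ
  omega

/-- The factor `q^((s+κ)/2)` in `ξ` absorbs the power of `q` in the functional equation of the
completed L-function, leaving only the root number. -/
theorem xi_half_sub {χ : DirichletCharacter ℂ q} (hχ : χ.IsPrimitive) (s : ℂ) :
    χ.xi (1 / 2 - s) = rootNumber χ * χ⁻¹.xi (1 / 2 + s) := by
  have hqC : (q : ℂ) ≠ 0 := Nat.cast_ne_zero.2 (NeZero.ne q)
  have h := hχ.completedLFunction_one_sub (1 / 2 + s)
  rw [show (1 : ℂ) - (1 / 2 + s) = 1 / 2 - s by ring, show (1 / 2 : ℂ) + s - 1 / 2 = s by ring] at h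
  have hp : (q : ℂ) ^ ((1 / 2 - s + χ.parity) / 2) * (q : ℂ) ^ s =
      (q : ℂ) ^ ((1 / 2 + s + χ.parity) / 2) := by
    rw [← Complex.cpow_add _ _ hqC]
    congr 1
    ring
  rw [xi, xi, parity_inv, h]
  linear_combination (rootNumber χ * completedLFunction χ⁻¹ (1 / 2 + s)) * hp

theorem xi_ne_zero_of_one_lt_re (hq : 1 < q) (χ : DirichletCharacter ℂ q) {s : ℂ}
    (hs : 1 < s.re) : χ.xi s ≠ 0 := by
  have hqC : (q : ℂ) ≠ 0 := Nat.cast_ne_zero.2 (NeZero.ne q)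
  refine mul_ne_zero (by simp [Complex.cpow_eq_zero_iff, hqC]) fun h => ?_
  have h1 : s ≠ 1 := fun h => by simp [h] at hs
  refine LFunction_ne_zero_of_one_le_re χ (Or.inr h1) hs.le ?_
  rw [LFunction_eq_completed_div_gammaFactor χ s (Or.inr hq.ne'), h, zero_div]

theorem rootNumber_ne_zero (hq : 1 < q) {χ : DirichletCharacter ℂ q} (hχ : χ.IsPrimitive) :
    rootNumber χ ≠ 0 := by
  intro h
  -- If the root number vanished, then `ξ(5/2, χ)` would be zero, inside the half-plane of
  -- nonvanishing.
  have := xi_half_sub hχ (-2)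
  rw [h, zero_mul] at this
  exact xi_ne_zero_of_one_lt_re hq χ (by norm_num) this

theorem xi_inv_eq_zero_iff (hq : 1 < q) {χ : DirichletCharacter ℂ q} (hχ : χ.IsPrimitive) (s : ℂ) :
    χ⁻¹.xi (1 / 2 + Complex.I * s) = 0 ↔ χ.xi (1 / 2 + Complex.I * -s) = 0 := by
  have h := xi_half_sub hχ (Complex.I * s)
  rw [mul_neg, ← sub_eq_add_neg, h]
  simp [rootNumber_ne_zero hq hχ]

theorem abs_im_le_of_xi_eq_zero (hq : 1 < q) {χ : DirichletCharacter ℂ q} (hχ : χ.IsPrimitive)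
    {s : ℂ} (h : χ.xi (1 / 2 + Complex.I * s) = 0) : |s.im| ≤ 1 / 2 := by
  rw [abs_le]
  constructor
  · by_contra hlt
    exact xi_ne_zero_of_one_lt_re hq χ (by simp at hlt ⊢; linarith) h
  · by_contra hlt
    have h' : χ⁻¹.xi (1 / 2 + Complex.I * -s) = 0 := by
      rw [xi_inv_eq_zero_iff hq hχ, neg_neg]; exact h
    exact xi_ne_zero_of_one_lt_re hq χ⁻¹ (by simp at hlt ⊢; linarith) h'

end DirichletCharacter

end

/-! ### Power series, the recursion and the determinant formula -/

section

open Filter Set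
open scoped Topology

/-- An everywhere convergent power series defines an entire function, whose derivatives at the
origin are given by the coefficients. -/
theorem differentiable_and_iteratedDeriv_of_hasSum {c : ℕ → ℂ} {F : ℂ → ℂ}
    (h : ∀ s, HasSum (fun n : ℕ => c n * s ^ n) (F s)) :
    Differentiable ℂ F ∧ ∀ n, iteratedDeriv n F 0 = n.factorial * c n := by
  have hball : HasFPowerSeriesOnBall F (FormalMultilinearSeries.ofScalars ℂ c) 0 ⊤ := by
    refine ⟨?_, by simp, fun {y} _ => ?_⟩
    · rw [FormalMultilinearSeries.radius_eq_top_of_summable_norm]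
      intro r
      refine (h (r : ℂ)).summable.norm.congr fun n => ?_
      rw [FormalMultilinearSeries.ofScalars_norm, norm_mul, norm_pow]
      simp
    · rw [zero_add]
      refine (h y).congr_fun fun n => ?_
      rw [FormalMultilinearSeries.ofScalars_apply_eq, smul_eq_mul]
  refine ⟨fun s => (hball.analyticAt_of_mem (by simp)).differentiableAt, fun n => ?_⟩
  have h1 := (hball.analyticAt).hasFPowerSeriesAt
  have h2 := h1.eq_formalMultilinearSeries hball.hasFPowerSeriesAt
  have h3 := congrFun (FormalMultilinearSeries.ofScalars_series_injective ℂ ℂ h2) n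
  have : (n.factorial : ℂ) ≠ 0 := Nat.cast_ne_zero.2 n.factorial_ne_zero
  rw [← h3]
  field_simp

theorem Finset.sum_range_two_mul {M : Type*} [AddCommMonoid M] (g : ℕ → M) (m : ℕ) :
    ∑ i ∈ Finset.range (2 * m), g i = ∑ k ∈ Finset.range m, (g (2 * k) + g (2 * k + 1)) := by
  induction m with
  | zero => simp
  | succ m ih =>
    rw [Nat.mul_succ, Finset.sum_range_succ, Finset.sum_range_succ, Finset.sum_range_succ, ih,
      add_assoc]

/-- This is the Leibniz rule for `f' = (f'/f) · f` near `0`, in terms of Taylor coefficients. -/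
theorem iteratedDeriv_deriv_eq_sum {f : ℂ → ℂ} (hf : Differentiable ℂ f) (h0 : f 0 ≠ 0) (N : ℕ) :
    ((N : ℂ) + 1) * (iteratedDeriv (N + 1) f 0 / (N + 1).factorial) =
      ∑ i ∈ Finset.range (N + 1), iteratedDeriv i (fun s => deriv f s / f s) 0 / i.factorial *
        (iteratedDeriv (N - i) f 0 / (N - i).factorial) := by
  have hψ : ContDiffAt ℂ N (fun s => deriv f s / f s) 0 :=
    ((hf.analyticAt 0).deriv.div (hf.analyticAt 0) h0).contDiffAt
  have heq : deriv f =ᶠ[𝓝 0] (fun s => deriv f s / f s) * f := by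
    filter_upwards [hf.continuous.continuousAt.eventually_ne h0] with s hs
    rw [Pi.mul_apply, div_mul_cancel₀ _ hs]
  have hN : (N.factorial : ℂ) ≠ 0 := Nat.cast_ne_zero.2 N.factorial_ne_zero
  rw [iteratedDeriv_succ', heq.iteratedDeriv_eq, iteratedDeriv_mul hψ hf.contDiff.contDiffAt,
    Nat.factorial_succ, Finset.sum_div, Finset.mul_sum]
  refine Finset.sum_congr rfl fun i hi => ?_
  have hi' : i ≤ N := by simpa [Nat.lt_succ_iff] using hi
  have hch : (N.choose i : ℂ) * (i.factorial * (N - i).factorial) = N.factorial := by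
    have := Nat.choose_mul_factorial_mul_factorial hi'
    rw [← mul_assoc]
    exact_mod_cast this
  have h1 : (i.factorial : ℂ) ≠ 0 := Nat.cast_ne_zero.2 i.factorial_ne_zero
  have h2 : ((N - i).factorial : ℂ) ≠ 0 := Nat.cast_ne_zero.2 (N - i).factorial_ne_zero
  have h3 : (N : ℂ) + 1 ≠ 0 := Nat.cast_add_one_ne_zero N
  push_cast
  field_simp
  rw [← hch]
  ring

namespace DirichletCharacter

variable {q : ℕ} [NeZero q]

omit [NeZero q] in
theorem inv_ne_one {χ : DirichletCharacter ℂ q} (hχ : χ ≠ 1) : χ⁻¹ ≠ 1 := by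
  rwa [Ne, inv_eq_one]

theorem neg_one_pow_mul_aCoeff (hq : 1 < q) {χ : DirichletCharacter ℂ q} (hχ : χ.IsPrimitive)
    (n : ℕ) : (-1) ^ n * χ.aCoeff n = rootNumber χ * χ⁻¹.aCoeff n := by
  have hχ1 := ne_one_of_isPrimitive hq hχ
  have h1 : ∀ s, HasSum (fun n : ℕ => (Complex.I ^ n * χ.aCoeff n * (-1) ^ n) * s ^ n)
      (χ.xi (1 / 2 + Complex.I * -s)) := fun s => by
    refine (hasSum_xi hq hχ1 (-s)).congr_fun fun n => ?_
    rw [neg_pow s]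
    ring
  have h2 : ∀ s, HasSum (fun n : ℕ => (rootNumber χ * (Complex.I ^ n * χ⁻¹.aCoeff n)) * s ^ n)
      (χ.xi (1 / 2 + Complex.I * -s)) := fun s => by
    rw [mul_neg, ← sub_eq_add_neg, xi_half_sub hχ]
    refine ((hasSum_xi hq (inv_ne_one hχ1) s).mul_left _).congr_fun fun n => ?_
    ring
  have h3 := ((differentiable_and_iteratedDeriv_of_hasSum h1).2 n).symm.trans
    ((differentiable_and_iteratedDeriv_of_hasSum h2).2 n)
  have h4 := mul_left_cancel₀ (Nat.cast_ne_zero.2 n.factorial_ne_zero) h3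
  have hI : Complex.I ^ n ≠ 0 := pow_ne_zero _ Complex.I_ne_zero
  refine mul_left_cancel₀ hI ?_
  linear_combination h4

theorem exists_aCoeff_ne_zero (hq : 1 < q) {χ : DirichletCharacter ℂ q} (hχ : χ ≠ 1) :
    {n : ℕ | χ.aCoeff n ≠ 0}.Nonempty := by
  by_contra h
  have h0 : ∀ n, χ.aCoeff n = 0 := fun n => by
    by_contra hn
    exact h ⟨n, hn⟩
  -- At this point `1/2 + is = 5/2`, where `ξ` does not vanish.
  have h1 := hasSum_xi hq hχ (-2 * Complex.I)
  simp only [h0, mul_zero, zero_mul] at h1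
  refine xi_ne_zero_of_one_lt_re hq χ ?_ (h1.unique hasSum_zero)
  simp
  norm_num

theorem aCoeff_mu_ne_zero (hq : 1 < q) {χ : DirichletCharacter ℂ q} (hχ : χ ≠ 1) :
    χ.aCoeff χ.mu ≠ 0 :=
  Nat.sInf_mem (exists_aCoeff_ne_zero hq hχ)

omit [NeZero q] in
theorem aCoeff_eq_zero_of_lt (χ : DirichletCharacter ℂ q) {n : ℕ} (hn : n < χ.mu) :
    χ.aCoeff n = 0 := by
  by_contra h
  exact Nat.notMem_of_lt_sInf hn h

theorem mu_inv (hq : 1 < q) {χ : DirichletCharacter ℂ q} (hχ : χ.IsPrimitive) :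
    χ⁻¹.mu = χ.mu := by
  have h : ∀ n, χ⁻¹.aCoeff n ≠ 0 ↔ χ.aCoeff n ≠ 0 := fun n => by
    have h1 := neg_one_pow_mul_aCoeff hq hχ n
    have h2 := rootNumber_ne_zero hq hχ
    have h3 : ((-1 : ℂ)) ^ n ≠ 0 := pow_ne_zero _ (by norm_num)
    constructor
    · intro h h'
      rw [h', mul_zero] at h1
      exact mul_ne_zero h2 h h1.symm
    · intro h h'
      rw [h', mul_zero] at h1
      exact mul_ne_zero h3 h h1
  simp only [mu, h]

/-- The function `ξ(1/2 + is, χ) / s^μ`, with the removable singularity removed. -/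
noncomputable def xiQuot (χ : DirichletCharacter ℂ q) (s : ℂ) : ℂ :=
  if s = 0 then Complex.I ^ χ.mu * χ.aCoeff χ.mu else χ.xi (1 / 2 + Complex.I * s) / s ^ χ.mu

theorem hasSum_xiQuot (hq : 1 < q) {χ : DirichletCharacter ℂ q} (hχ : χ ≠ 1) (s : ℂ) :
    HasSum (fun n : ℕ => Complex.I ^ (n + χ.mu) * χ.aCoeff (n + χ.mu) * s ^ n) (χ.xiQuot s) := by
  by_cases hs : s = 0
  · have := hasSum_single (f := fun n : ℕ =>
      Complex.I ^ (n + χ.mu) * χ.aCoeff (n + χ.mu) * s ^ n) 0 fun n hn => by simp [hs, hn]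
    simpa [xiQuot, hs] using this
  · have h1 := (hasSum_nat_add_iff' χ.mu).2 (hasSum_xi hq hχ s)
    rw [Finset.sum_eq_zero fun n hn => by
      rw [χ.aCoeff_eq_zero_of_lt (Finset.mem_range.1 hn)]; ring, sub_zero] at h1
    rw [xiQuot, if_neg hs]
    refine (h1.div_const (s ^ χ.mu)).congr_fun fun n => ?_
    rw [pow_add s]
    field_simp

theorem hasSum_xiQuot_mul (hq : 1 < q) {χ : DirichletCharacter ℂ q} (hχ : χ.IsPrimitive) (s : ℂ) :
    HasSum (fun n : ℕ => (-1) ^ n * χ.bCoeff n * s ^ (2 * n)) (χ.xiQuot s * χ⁻¹.xiQuot s) := by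
  have hχ1 := ne_one_of_isPrimitive hq hχ
  have hA := hasSum_xiQuot hq hχ1 s
  have hB := hasSum_xiQuot hq (inv_ne_one hχ1) s
  rw [mu_inv hq hχ] at hB
  set μ := χ.mu with hμ
  set c : ℕ → ℂ := fun N => ∑ j ∈ Finset.range (N + 1),
    (Complex.I ^ (j + μ) * χ.aCoeff (j + μ) * s ^ j) *
      (Complex.I ^ (N - j + μ) * χ⁻¹.aCoeff (N - j + μ) * s ^ (N - j)) with hc
  have hprod : HasSum c (χ.xiQuot s * χ⁻¹.xiQuot s) := by
    have h1 := tsum_mul_tsum_eq_tsum_sum_range_of_summable_norm hA.summable.norm hB.summable.norm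
    have h2 := (summable_norm_sum_mul_range_of_summable_norm hA.summable.norm
      hB.summable.norm).of_norm
    rw [← hA.tsum_eq, ← hB.tsum_eq, h1]
    exact h2.hasSum
  have hc' : ∀ N, c N = Complex.I ^ (N + 2 * μ) * (∑ j ∈ Finset.range (N + 1),
      χ.aCoeff (j + μ) * χ⁻¹.aCoeff (N - j + μ)) * s ^ N := by
    intro N
    simp only [hc]
    rw [Finset.mul_sum, Finset.sum_mul]
    refine Finset.sum_congr rfl fun j hj => ?_
    have hj' : j ≤ N := by simpa [Nat.lt_succ_iff] using hj
    obtain ⟨k, rfl⟩ := Nat.exists_eq_add_of_le hj'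
    rw [Nat.add_sub_cancel_left]
    ring
  -- Since `a_i(χ̄)` is `(-1)^i a_i(χ)` up to a constant, exchanging `j` and `N - j` multiplies each
  -- term by `(-1)^N`, so for odd `N` the sum is its own negative.
  have hodd : ∀ N, _root_.Odd N → c N = 0 := by
    intro N hN
    have hε := rootNumber_ne_zero hq hχ
    have hS : ∑ j ∈ Finset.range (N + 1), χ.aCoeff (j + μ) * χ⁻¹.aCoeff (N - j + μ) =
        -∑ j ∈ Finset.range (N + 1), χ.aCoeff (j + μ) * χ⁻¹.aCoeff (N - j + μ) := by
      conv_lhs => rw [← Finset.sum_range_reflect]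
      rw [← Finset.sum_neg_distrib]
      refine Finset.sum_congr rfl fun j hj => ?_
      have hj' : j ≤ N := by simpa [Nat.lt_succ_iff] using hj
      obtain ⟨k, rfl⟩ := Nat.exists_eq_add_of_le hj'
      rw [show j + k + 1 - 1 - j = k by omega, show j + k - k = j by omega,
        show j + k - j = k by omega]
      have e1 := neg_one_pow_mul_aCoeff hq hχ (j + μ)
      have e2 := neg_one_pow_mul_aCoeff hq hχ (k + μ)
      have e3 : (-1 : ℂ) ^ (j + μ) * (-1) ^ (k + μ) = -1 := by
        rw [← pow_add, show j + μ + (k + μ) = j + k + 2 * μ by ring, pow_add, pow_mul, hN.neg_one_pow]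
        simp
      have e4 : (-1 : ℂ) ^ (k + μ) * (-1) ^ (k + μ) = 1 := by rw [← mul_pow]; simp
      have e5 : (-1 : ℂ) ^ (j + μ) = -(-1) ^ (k + μ) := by
        linear_combination (-1) ^ (k + μ) * e3 - (-1) ^ (j + μ) * e4
      refine mul_left_cancel₀ hε ?_
      linear_combination (-χ.aCoeff (k + μ)) * e1 - χ.aCoeff (j + μ) * e2 +
        χ.aCoeff (j + μ) * χ.aCoeff (k + μ) * e5
    have h0 : ∑ j ∈ Finset.range (N + 1), χ.aCoeff (j + μ) * χ⁻¹.aCoeff (N - j + μ) = 0 := by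
      linear_combination (1 / 2 : ℂ) * hS
    rw [hc', h0]
    ring
  have hinj : Function.Injective fun n : ℕ => 2 * n := fun a b hab => by simpa using hab
  rw [← hinj.hasSum_iff] at hprod
  · refine hprod.congr_fun fun n => ?_
    rw [Function.comp_apply, hc', bCoeff, MulChar.star_eq_inv, ← hμ, show 2 * n + 2 * μ = 2 * (n + μ) by ring,
      pow_mul Complex.I, Complex.I_sq, pow_add]
    ring
  · intro N hN
    refine hodd N ?_
    rw [← Nat.not_even_iff_odd]
    rintro ⟨k, rfl⟩
    exact hN ⟨k, by simp; ring⟩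

theorem fFun_eq (hq : 1 < q) {χ : DirichletCharacter ℂ q} (hχ : χ.IsPrimitive) (s : ℂ) :
    χ.fFun s = χ.xiQuot s * χ⁻¹.xiQuot s := by
  have hne : ∀ z : ℂ, z ≠ 0 → χ.xiProd (1 / 2 + Complex.I * z) / z ^ (2 * χ.mu) =
      χ.xiQuot z * χ⁻¹.xiQuot z := fun z hz => by
    rw [xiProd, MulChar.star_eq_inv, xiQuot, xiQuot, if_neg hz, if_neg hz, mu_inv hq hχ,
      div_mul_div_comm, ← pow_add, two_mul]
  by_cases hs : s = 0
  · subst hs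
    rw [fFun, Function.update_self]
    refine Tendsto.limUnder_eq ?_
    have hinj : Function.Injective fun n : ℕ => 2 * n := fun a b hab => by simpa using hab
    have hdiff : Differentiable ℂ fun z => χ.xiQuot z * χ⁻¹.xiQuot z := by
      have hχ1 := ne_one_of_isPrimitive hq hχ
      have hd : ∀ {ψ : DirichletCharacter ℂ q}, ψ ≠ 1 → Differentiable ℂ ψ.xiQuot := fun hψ =>
        (differentiable_and_iteratedDeriv_of_hasSum (hasSum_xiQuot hq hψ)).1
      exact (hd hχ1).mul (hd (inv_ne_one hχ1))
    refine (hdiff.continuous.continuousAt.tendsto.mono_left nhdsWithin_le_nhds).congr' ?_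
    filter_upwards [self_mem_nhdsWithin] with z hz
    exact (hne z hz).symm
  · rw [fFun, Function.update_of_ne hs, hne s hs]

theorem hasSum_fFun (hq : 1 < q) {χ : DirichletCharacter ℂ q} (hχ : χ.IsPrimitive) (s : ℂ) :
    HasSum (fun n : ℕ => (-1) ^ n * χ.bCoeff n * s ^ (2 * n)) (χ.fFun s) := by
  rw [fFun_eq hq hχ]
  exact hasSum_xiQuot_mul hq hχ s

omit [NeZero q] in
theorem bCoeff_zero (χ : DirichletCharacter ℂ q) :
    χ.bCoeff 0 = (-1) ^ χ.mu * (χ.aCoeff χ.mu * χ⁻¹.aCoeff χ.mu) := by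
  simp [bCoeff, MulChar.star_eq_inv]

theorem bCoeff_zero_ne_zero (hq : 1 < q) {χ : DirichletCharacter ℂ q} (hχ : χ.IsPrimitive) :
    χ.bCoeff 0 ≠ 0 := by
  have hχ1 := ne_one_of_isPrimitive hq hχ
  rw [bCoeff_zero]
  refine mul_ne_zero (pow_ne_zero _ (by norm_num)) (mul_ne_zero (aCoeff_mu_ne_zero hq hχ1) ?_)
  rw [← mu_inv hq hχ]
  exact aCoeff_mu_ne_zero hq (inv_ne_one hχ1)

theorem hasSum_fFun' (hq : 1 < q) {χ : DirichletCharacter ℂ q} (hχ : χ.IsPrimitive) (s : ℂ) :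
    HasSum (fun N : ℕ => (if 2 ∣ N then (-1) ^ (N / 2) * χ.bCoeff (N / 2) else 0) * s ^ N)
      (χ.fFun s) := by
  have hinj : Function.Injective fun n : ℕ => 2 * n := fun a b hab => by simpa using hab
  rw [← hinj.hasSum_iff]
  · refine (hasSum_fFun hq hχ s).congr_fun fun n => ?_
    simp
  · intro N hN
    rw [if_neg, zero_mul]
    rintro ⟨k, rfl⟩
    exact hN ⟨k, rfl⟩

theorem differentiable_fFun (hq : 1 < q) {χ : DirichletCharacter ℂ q} (hχ : χ.IsPrimitive) :
    Differentiable ℂ χ.fFun :=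
  (differentiable_and_iteratedDeriv_of_hasSum (hasSum_fFun' hq hχ)).1

theorem iteratedDeriv_two_mul_fFun (hq : 1 < q) {χ : DirichletCharacter ℂ q}
    (hχ : χ.IsPrimitive) (n : ℕ) :
    iteratedDeriv (2 * n) χ.fFun 0 / (2 * n).factorial = (-1) ^ n * χ.bCoeff n := by
  rw [(differentiable_and_iteratedDeriv_of_hasSum (hasSum_fFun' hq hχ)).2,
    mul_div_cancel_left₀ _ (Nat.cast_ne_zero.2 (Nat.factorial_ne_zero _))]
  simp

theorem iteratedDeriv_fFun_of_odd (hq : 1 < q) {χ : DirichletCharacter ℂ q}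
    (hχ : χ.IsPrimitive) {n : ℕ} (hn : ¬ 2 ∣ n) :
    iteratedDeriv n χ.fFun 0 / n.factorial = 0 := by
  rw [(differentiable_and_iteratedDeriv_of_hasSum (hasSum_fFun' hq hχ)).2, if_neg hn]
  simp

theorem fFun_zero (hq : 1 < q) {χ : DirichletCharacter ℂ q} (hχ : χ.IsPrimitive) :
    χ.fFun 0 = χ.bCoeff 0 := by
  simpa using iteratedDeriv_two_mul_fFun hq hχ 0

theorem fFun_neg (hq : 1 < q) {χ : DirichletCharacter ℂ q} (hχ : χ.IsPrimitive) (s : ℂ) :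
    χ.fFun (-s) = χ.fFun s := by
  refine (hasSum_fFun hq hχ (-s)).unique ((hasSum_fFun hq hχ s).congr_fun fun n => ?_)
  rw [pow_mul, pow_mul, neg_sq]

theorem iteratedDeriv_logDeriv_fFun (χ : DirichletCharacter ℂ q) (k : ℕ) :
    iteratedDeriv (2 * k + 3) (fun s => deriv χ.fFun s / χ.fFun s) 0 / (2 * k + 3).factorial =
      -2 * χ.moment k := by
  rw [moment]
  ring

theorem iteratedDeriv_one_logDeriv_fFun (hq : 1 < q) {χ : DirichletCharacter ℂ q}
    (hχ : χ.IsPrimitive) :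
    iteratedDeriv 1 (fun s => deriv χ.fFun s / χ.fFun s) 0 =
      -2 * (χ.bCoeff 1 / χ.bCoeff 0) := by
  have hb := bCoeff_zero_ne_zero hq hχ
  have h0 : χ.fFun 0 ≠ 0 := by rwa [fFun_zero hq hχ]
  have h := iteratedDeriv_deriv_eq_sum (differentiable_fFun hq hχ) h0 1
  have h2 := iteratedDeriv_two_mul_fFun hq hχ 1
  have h1 := iteratedDeriv_fFun_of_odd hq hχ (n := 1) (by norm_num)
  have h3 := iteratedDeriv_two_mul_fFun hq hχ 0
  norm_num [Finset.sum_range_succ] at h h1 h2 h3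
  rw [h2, h3, h1] at h
  norm_num [Finset.sum_range_succ]
  field_simp
  linear_combination -h

/-- The convolution form of the recursion, from which both the recursion and the determinant formula
follow. -/
theorem sum_moment_mul_bCoeff (hq : 1 < q) {χ : DirichletCharacter ℂ q} (hχ : χ.IsPrimitive)
    (n : ℕ) :
    ∑ k ∈ Finset.range (n + 1), (-1) ^ k * χ.moment k * χ.bCoeff (n - k) / χ.bCoeff 0 =
      χ.bCoeff 1 * χ.bCoeff (n + 1) / χ.bCoeff 0 ^ 2 -
        (n + 2) * χ.bCoeff (n + 2) / χ.bCoeff 0 := by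
  have hb := bCoeff_zero_ne_zero hq hχ
  have h0 : χ.fFun 0 ≠ 0 := by rwa [fFun_zero hq hχ]
  -- Coefficient of `s^(2n+3)`. Even-degree terms of `f'/f` meet odd coefficients of `f` and drop
  -- out. Degree one gives the `b₁` term, and the remaining odd degrees `2k + 3` give the moments.
  have h := iteratedDeriv_deriv_eq_sum (differentiable_fFun hq hχ) h0 (2 * n + 3)
  rw [show 2 * n + 3 + 1 = 2 * (n + 2) by ring, iteratedDeriv_two_mul_fFun hq hχ,
    Finset.sum_range_two_mul, Finset.sum_range_succ'] at h
  rw [Finset.sum_congr rfl (g := fun k => -2 * (-1) ^ n * χ.bCoeff 0 *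
    ((-1) ^ k * χ.moment k * χ.bCoeff (n - k) / χ.bCoeff 0)) fun k hk => by
      have hk' : k ≤ n := by simpa [Nat.lt_succ_iff] using hk
      obtain ⟨j, rfl⟩ := Nat.exists_eq_add_of_le hk'
      rw [show 2 * (k + 1) + 1 = 2 * k + 3 by ring, iteratedDeriv_logDeriv_fFun,
        iteratedDeriv_fFun_of_odd hq hχ (n := 2 * (k + j) + 3 - 2 * (k + 1)) (by omega),
        show 2 * (k + j) + 3 - (2 * k + 3) = 2 * j by omega, iteratedDeriv_two_mul_fFun hq hχ,
        Nat.add_sub_cancel_left]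
      field_simp
      have hk2 : ((-1 : ℂ)) ^ k * (-1) ^ k = 1 := by rw [← mul_pow]; simp
      rw [pow_add]
      linear_combination (2 * (2 * (k + 1)).factorial * χ.moment k * χ.bCoeff j * (-1) ^ j) * hk2, ← Finset.mul_sum, iteratedDeriv_fFun_of_odd hq hχ (n := 2 * n + 3 - 2 * 0) (by omega),
    show 2 * 0 + 1 = 1 by rfl, iteratedDeriv_one_logDeriv_fFun hq hχ,
    show 2 * n + 3 - 1 = 2 * (n + 1) by omega, iteratedDeriv_two_mul_fFun hq hχ] at h
  set S := ∑ k ∈ Finset.range (n + 1), (-1) ^ k * χ.moment k * χ.bCoeff (n - k) / χ.bCoeff 0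
  push_cast at h
  field_simp at h ⊢
  rw [pow_succ, pow_succ] at h
  simp only [Nat.factorial_zero, Nat.factorial_one, Nat.cast_one, mul_one, mul_zero] at h
  refine mul_left_cancel₀ (pow_ne_zero n (neg_ne_zero.2 (one_ne_zero (α := ℂ)))) ?_
  linear_combination (1 / 2 : ℂ) * h

theorem neg_one_pow_mul_moment (hq : 1 < q) {χ : DirichletCharacter ℂ q} (hχ : χ.IsPrimitive)
    (n : ℕ) : (-1) ^ n * χ.moment n =
      χ.bCoeff 1 * χ.bCoeff (n + 1) / χ.bCoeff 0 ^ 2 - (n + 2) * χ.bCoeff (n + 2) / χ.bCoeff 0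
        - ∑ k ∈ Finset.range n, (-1) ^ k * χ.moment k * χ.bCoeff (n - k) / χ.bCoeff 0 := by
  have hb := bCoeff_zero_ne_zero hq hχ
  rw [← sum_moment_mul_bCoeff hq hχ, Finset.sum_range_succ, Nat.sub_self, mul_div_cancel_right₀ _ hb]
  ring

/-- Cramer's rule: with `T` the unitriangular Toeplitz matrix of the `b_i/b₀` and `x` the vector of
`(-1)^j m_j`, the given matrix is `T` with its last column replaced by `T x`. -/
theorem moment_eq_det (hq : 1 < q) {χ : DirichletCharacter ℂ q} (hχ : χ.IsPrimitive) (n : ℕ) :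
    χ.moment n = (-1) ^ n * (χ.momentMatrix n).det := by
  have hb := bCoeff_zero_ne_zero hq hχ
  set T : Matrix (Fin (n + 1)) (Fin (n + 1)) ℂ :=
    Matrix.of fun i j => if (j : ℕ) ≤ i then χ.bCoeff (i - j) / χ.bCoeff 0 else 0 with hT
  set x : Fin (n + 1) → ℂ := fun j => (-1) ^ (j : ℕ) * χ.moment j with hx
  have hdet : T.det = 1 := by
    rw [Matrix.det_of_isLowerTriangular]
    · refine Finset.prod_eq_one fun i _ => ?_
      simp [hT, hb]
    · intro i j hij
      have : ¬ (j : ℕ) ≤ i := not_le.2 hij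
      rw [hT, Matrix.of_apply, if_neg this]
  have hM : χ.momentMatrix n = T.updateCol (Fin.last n) (T.mulVec x) := by
    ext i j
    rw [Matrix.updateCol_apply]
    by_cases hj : j = Fin.last n
    · rw [if_pos hj, hj, momentMatrix, Matrix.of_apply, if_pos (by simp),
        ← sum_moment_mul_bCoeff hq hχ, Matrix.mulVec, dotProduct]
      simp only [hT, hx, Matrix.of_apply]
      rw [Fin.sum_univ_eq_sum_range (fun j => (if j ≤ (i : ℕ) then
        χ.bCoeff (i - j) / χ.bCoeff 0 else 0) * ((-1) ^ j * χ.moment j)) (n + 1)]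
      refine Finset.sum_subset_zero_on_sdiff (Finset.range_subset_range.2 i.2) (fun k hk => ?_)
        fun k hk => ?_
      · rw [Finset.mem_sdiff, Finset.mem_range, Finset.mem_range] at hk
        rw [if_neg (by omega), zero_mul]
      · rw [Finset.mem_range] at hk
        rw [if_pos (by omega)]
        ring
    · have : (j : ℕ) ≠ n := fun h => hj (Fin.ext (by simpa using h))
      simp [momentMatrix, hj, this, hT]
  have hcr : (T.updateCol (Fin.last n) (T.mulVec x)).det = x (Fin.last n) := by
    rw [← Matrix.cramer_apply, Matrix.cramer_eq_adjugate_mulVec, Matrix.mulVec_mulVec,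
      Matrix.adjugate_mul, hdet, one_smul, Matrix.one_mulVec]
  rw [hM, hcr, hx]
  simp only [Fin.val_last]
  rw [← mul_assoc, ← mul_pow]
  simp

theorem bCoeff_div_bCoeff_zero (hq : 1 < q) {χ : DirichletCharacter ℂ q} (hχ : χ.IsPrimitive)
    (n : ℕ) : χ.bCoeff n / χ.bCoeff 0 = ∑ j ∈ Finset.range (2 * n + 1),
      (-1) ^ j * (χ.aCoeff (j + χ.mu) / χ.aCoeff χ.mu) *
        (χ.aCoeff (2 * n - j + χ.mu) / χ.aCoeff χ.mu) := by
  have hχ1 := ne_one_of_isPrimitive hq hχ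
  have ha := aCoeff_mu_ne_zero hq hχ1
  have hε := rootNumber_ne_zero hq hχ
  have h : ∀ k, χ⁻¹.aCoeff k = (rootNumber χ)⁻¹ * ((-1) ^ k * χ.aCoeff k) := fun k => by
    rw [neg_one_pow_mul_aCoeff hq hχ, inv_mul_cancel_left₀ hε]
  have h1 : ((-1 : ℂ)) ^ χ.mu ≠ 0 := pow_ne_zero _ (by norm_num)
  rw [bCoeff_zero, bCoeff, mul_div_mul_left _ _ h1, MulChar.star_eq_inv, Finset.sum_div]
  refine Finset.sum_congr rfl fun j hj => ?_
  have hj' : j ≤ 2 * n := by simpa [Nat.lt_succ_iff] using hj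
  have hs : ((-1 : ℂ)) ^ (2 * n - j + χ.mu) = (-1) ^ j * (-1) ^ χ.mu := by
    rw [pow_add, neg_one_pow_congr (m := 2 * n - j) (n := j) (by simp [Nat.even_sub hj'])]
  rw [h, h, hs]
  field_simp

end DirichletCharacter

end

/-! ### Real zeros, complete monotonicity, and the criterion -/

section

open Filter Set
open scoped Topology

namespace EntireFunction

theorem hasSum_iteratedDeriv_of_analyticAt {g : ℂ → ℂ} (hg : AnalyticAt ℂ g 0) :
    ∀ᶠ s in 𝓝 (0 : ℂ), HasSum (fun n : ℕ => iteratedDeriv n g 0 / n.factorial * s ^ n) (g s) := by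
  filter_upwards [hg.hasFPowerSeriesAt.eventually_hasSum] with s hs
  rw [zero_add] at hs
  refine hs.congr_fun fun n => ?_
  rw [FormalMultilinearSeries.ofScalars_apply_eq, smul_eq_mul]

theorem iteratedDeriv_eq_zero_of_odd {g : ℂ → ℂ} (hg : ∀ s, g (-s) = -g s) {n : ℕ} (hn : Even n) :
    iteratedDeriv n g 0 = 0 := by
  have h1 := iteratedDeriv_comp_neg n g 0
  rw [funext hg, neg_zero, hn.neg_one_pow, one_smul] at h1
  have h2 : iteratedDeriv n (fun x => -g x) 0 = -iteratedDeriv n g 0 :=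
    iteratedDeriv_fun_neg n g 0
  rw [h2] at h1
  linear_combination (-1 / 2 : ℂ) * h1

/-- If the odd Taylor coefficients of `f' / f` from the third on are, up to scaling, the moments
of a measure on `[0, 1]`, then the even entire function `f` has only real zeros. -/
theorem im_eq_zero_of_moments {f : ℂ → ℂ} (hf : Differentiable ℂ f) (h0 : f 0 ≠ 0)
    (heven : ∀ s, f (-s) = f s) {L : ℝ} (hL : 0 < L) {c : ℕ → ℝ}
    (hc : ∀ n k, 0 ≤ ∑ j ∈ Finset.range (k + 1), (-1) ^ j * (k.choose j : ℝ) * c (n + j))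
    (hfc : ∀ n, iteratedDeriv (2 * n + 3) (fun s => deriv f s / f s) 0 / (2 * n + 3).factorial =
      -2 * (L ^ n * c n)) {s : ℂ} (hs : f s = 0) : s.im = 0 := by
  obtain ⟨Φ, hΦ, hsum⟩ := HausdorffMoment.exists_analytic_continuation hc
  set ψ : ℂ → ℂ := fun s => deriv f s / f s with hψ
  -- The continuation of `f'/f`. The linear coefficient is kept apart because the moments start only
  -- at degree three.
  set A : ℂ → ℂ := fun s => iteratedDeriv 1 ψ 0 * s - 2 * s ^ 3 * Φ (L * s ^ 2) with hA
  set U : Set ℂ := (fun s : ℂ => 1 - L * s ^ 2) ⁻¹' Complex.slitPlane with hU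
  have hUo : IsOpen U := Complex.isOpen_slitPlane.preimage (by fun_prop)
  have h0U : (0 : ℂ) ∈ U := by simp [hU]
  -- `1 - L t² x²` is the convex combination of `1` and `1 - L x²` with weights `1 - t²` and `t²`,
  -- and the slit plane is star-shaped about `1`.
  have hstar : StarConvex ℝ (0 : ℂ) U := by
    rw [starConvex_zero_iff]
    intro x hx t ht0 ht1
    have := Complex.starConvex_one_slitPlane hx (a := 1 - t ^ 2) (b := t ^ 2)
      (by nlinarith) (by positivity) (by ring)
    rw [hU, mem_preimage]
    convert this using 1
    simp only [Complex.real_smul]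
    push_cast
    ring
  have hUc : IsPreconnected U := (hstar.isPathConnected h0U).isConnected.isPreconnected
  have hAU : DifferentiableOn ℂ A U := by
    intro z hz
    refine DifferentiableAt.differentiableWithinAt ?_
    have hd : DifferentiableAt ℂ Φ (L * z ^ 2) := by
      refine hΦ _ fun t ht h => ?_
      have ht0 : t ≠ 0 := by
        rintro rfl
        simp at h
      have ht0' : (t : ℂ) ≠ 0 := by exact_mod_cast ht0
      have hw : (1 : ℂ) - L * z ^ 2 = ((1 - t⁻¹ : ℝ) : ℂ) := by
        rw [eq_div_of_mul_eq ht0' h]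
        push_cast
        rw [one_div]
      rw [hU, mem_preimage, hw, Complex.ofReal_mem_slitPlane] at hz
      have : 1 ≤ t⁻¹ := (one_le_inv₀ (lt_of_le_of_ne ht.1 (Ne.symm ht0))).2 ht.2
      linarith
    have hcomp : DifferentiableAt ℂ (fun z : ℂ => Φ (L * z ^ 2)) z :=
      DifferentiableAt.comp (g := Φ) (f := fun z : ℂ => L * z ^ 2) z hd (by fun_prop)
    exact (differentiableAt_id.const_mul _).sub (by fun_prop)
  have hodd : ∀ s, ψ (-s) = -ψ s := fun s => by
    have h1 : deriv f (-s) = -deriv f s := by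
      have := deriv_comp_neg f s
      rw [funext heven] at this
      rw [this, neg_neg]
    simp only [hψ]
    rw [h1, heven, neg_div]
  have hψan : AnalyticAt ℂ ψ 0 := (hf.analyticAt 0).deriv.div (hf.analyticAt 0) h0
  have hnear : ∀ᶠ s in 𝓝 (0 : ℂ), ψ s = A s := by
    have hsmall : ∀ᶠ s in 𝓝 (0 : ℂ), ‖(L : ℂ) * s ^ 2‖ < 1 := by
      have : ContinuousAt (fun s : ℂ => ‖(L : ℂ) * s ^ 2‖) 0 := by fun_prop
      exact this.eventually_lt continuousAt_const (by simp)
    filter_upwards [hasSum_iteratedDeriv_of_analyticAt hψan, hsmall] with s h1 h2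
    have hinj : Function.Injective fun n : ℕ => 2 * n + 1 := fun a b hab => by simpa using hab
    rw [← hinj.hasSum_iff] at h1
    · refine h1.unique ?_
      rw [← hasSum_nat_add_iff' 1]
      refine HasSum.congr_fun (f := fun n : ℕ => -2 * s ^ 3 * ((c n : ℂ) * (L * s ^ 2) ^ n)) ?_ ?_
      · have h3 := (hsum _ h2).mul_left (-2 * s ^ 3)
        have h4 : A s - ∑ i ∈ Finset.range 1,
            ((fun n : ℕ => iteratedDeriv n ψ 0 / n.factorial * s ^ n) ∘ fun n => 2 * n + 1) i =
            -2 * s ^ 3 * Φ (L * s ^ 2) := by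
          simp only [Finset.sum_range_one, Function.comp_apply, hA, mul_zero, zero_add,
            Nat.factorial_one, Nat.cast_one]
          ring
        rw [h4]
        exact h3
      · intro n
        rw [Function.comp_apply, show 2 * (n + 1) + 1 = 2 * n + 3 by ring, hfc, mul_pow]
        ring
    · intro n hn
      have : Even n := by
        rw [← Nat.not_odd_iff_even]
        rintro ⟨k, rfl⟩
        exact hn ⟨k, rfl⟩
      rw [iteratedDeriv_eq_zero_of_odd hodd this]
      simp
  have hEq : EqOn (deriv f) (A * f) U := by
    refine AnalyticOnNhd.eqOn_of_preconnected_of_eventuallyEq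
      (fun z _ => (hf.analyticAt z).deriv)
      (fun z hz => (hAU.analyticAt (hUo.mem_nhds hz)).mul (hf.analyticAt z)) hUc h0U ?_
    filter_upwards [hnear, hf.continuous.continuousAt.eventually_ne h0] with z hz hz0
    rw [Pi.mul_apply, ← hz, div_mul_cancel₀ _ hz0]
  by_contra him
  have hsU : s ∈ U := by
    rw [hU, mem_preimage, Complex.mem_slitPlane_iff]
    by_cases hre : s.re = 0
    · left
      have : 0 < L * s.im ^ 2 := by positivity
      simp [pow_two, hre]
      nlinarith
    · right
      simp [pow_two]
      refine ⟨hL.ne', fun h => ?_⟩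
      have : s.re * s.im = 0 := by linarith
      rcases mul_eq_zero.1 this with h | h <;> contradiction
  have hfs := hf.analyticAt s
  -- On `U` the relation `f' = A f` forces `f'` to vanish at `s` at least to the order of `f`,
  -- whereas differentiation lowers the order of a zero by one.
  have h1 : analyticOrderAt (deriv f) s = analyticOrderAt A s + analyticOrderAt f s := by
    rw [← analyticOrderAt_mul (hAU.analyticAt (hUo.mem_nhds hsU)) hfs]
    exact analyticOrderAt_congr (hEq.eventuallyEq_of_mem (hUo.mem_nhds hsU))
  have h2 : analyticOrderAt (deriv f) s + 1 = analyticOrderAt f s := by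
    simpa [hs] using hfs.analyticOrderAt_deriv_add_one
  have h3 : analyticOrderAt f s ≠ ⊤ := analyticOrderAt_ne_top hf h0 s
  rw [h1] at h2
  have h4 : analyticOrderAt f s + 1 ≤ analyticOrderAt f s := by
    conv_rhs => rw [← h2]
    gcongr
    exact le_add_self
  exact absurd ((ENat.lt_add_one_iff h3).2 le_rfl) (not_lt.2 h4)

/-- The scaled odd Taylor coefficients of `f' / f` from the third on are the moments of a measure
on `[0, 1]` if `f` has only real zeros. -/
theorem moments_nonneg {f : ℂ → ℂ} (hg : SubGaussian f) (hf : Differentiable ℂ f) (h0 : f 0 ≠ 0)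
    (hreal : ∀ z, f z = 0 → z.im = 0) {L : ℝ} (hL : 0 < L)
    (hz : ∀ z, f z = 0 → 1 ≤ L * z.re ^ 2) (n k : ℕ) :
    0 ≤ ∑ j ∈ Finset.range (k + 1), (-1) ^ j * (k.choose j : ℂ) *
      (-(1 / 2) * (iteratedDeriv (2 * (n + j) + 3) (logDeriv f) 0 / (2 * (n + j) + 3).factorial) /
        (L : ℂ) ^ (n + j)) := by
  have hlim : ∀ N, Tendsto (fun R : ℝ => 1 / 2 * ∑ w ∈ zerosIn f R,
      (analyticOrderNatAt f w : ℂ) * w⁻¹ ^ (2 * N + 4)) atTop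
      (𝓝 (-(1 / 2) * (iteratedDeriv (2 * N + 3) (logDeriv f) 0 / (2 * N + 3).factorial))) := by
    intro N
    obtain ⟨D, hD⟩ := hg.exists_norm_add_sum_inv_pow_le hf h0 hreal (k := 2 * N + 3) (by omega)
    have h1 : Tendsto (fun R : ℝ => iteratedDeriv (2 * N + 3) (logDeriv f) 0 /
        (2 * N + 3).factorial + ∑ w ∈ zerosIn f R,
        (analyticOrderNatAt f w : ℂ) * w⁻¹ ^ (2 * N + 3 + 1)) atTop (𝓝 0) := by
      have h2 : Tendsto (fun R : ℝ => D / R ^ 2) atTop (𝓝 0) :=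
        tendsto_const_nhds.div_atTop (tendsto_pow_atTop two_ne_zero)
      refine squeeze_zero_norm' ?_ h2
      filter_upwards [eventually_ge_atTop 1] with R hR using hD R hR
    have h2 := (h1.const_mul (1 / 2)).add_const
      (-(1 / 2) * (iteratedDeriv (2 * N + 3) (logDeriv f) 0 / (2 * N + 3).factorial))
    rw [mul_zero, zero_add] at h2
    refine h2.congr fun R => ?_
    ring
  have hsum := tendsto_finsetSum (Finset.range (k + 1)) fun j _ =>
    ((hlim (n + j)).div_const ((L : ℂ) ^ (n + j))).const_mul ((-1) ^ j * (k.choose j : ℂ))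
  refine ge_of_tendsto' hsum fun R => ?_
  have hL' : (L : ℂ) ≠ 0 := by exact_mod_cast hL.ne'
  -- For finitely many zeros the alternating sum is the integral of `x^n (1 - x)^k` against masses
  -- at the points `x = w⁻²/L`, which lie in `[0, 1]`.
  have heq : ∑ j ∈ Finset.range (k + 1), (-1) ^ j * (k.choose j : ℂ) * ((1 / 2 *
      ∑ w ∈ zerosIn f R, (analyticOrderNatAt f w : ℂ) * w⁻¹ ^ (2 * (n + j) + 4)) /
        (L : ℂ) ^ (n + j)) =
      ∑ w ∈ zerosIn f R, 1 / 2 * (analyticOrderNatAt f w : ℂ) * w⁻¹ ^ 4 *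
        (w⁻¹ ^ 2 / L) ^ n * (1 - w⁻¹ ^ 2 / L) ^ k := by
    simp_rw [Finset.mul_sum, Finset.sum_div, Finset.mul_sum]
    rw [Finset.sum_comm]
    refine Finset.sum_congr rfl fun w _ => ?_
    rw [sub_eq_neg_add, add_pow, Finset.mul_sum]
    refine Finset.sum_congr rfl fun j _ => ?_
    rw [neg_pow (w⁻¹ ^ 2 / (L : ℂ)), one_pow, div_pow, div_pow, pow_add (L : ℂ)]
    field_simp
    ring
  rw [heq]
  refine Finset.sum_nonneg fun w hw => ?_
  have hw0 := ((mem_zerosIn hf h0).1 hw).2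
  have hwr : w = (w.re : ℂ) := Complex.ext rfl (by simpa using hreal w hw0)
  have h1 := hz w hw0
  have hre : w.re ≠ 0 := by
    intro h
    rw [h] at h1
    norm_num at h1
  have h2 : w.re⁻¹ ^ 2 / L ≤ 1 := by
    rw [div_le_one hL, inv_pow, inv_le_iff_one_le_mul₀ (by positivity)]
    exact h1
  have h3 : (0 : ℝ) ≤ 1 / 2 * (analyticOrderNatAt f w : ℝ) * w.re⁻¹ ^ 4 *
      (w.re⁻¹ ^ 2 / L) ^ n * (1 - w.re⁻¹ ^ 2 / L) ^ k := by
    have : 0 ≤ 1 - w.re⁻¹ ^ 2 / L := by linarith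
    positivity
  have h4 : (1 / 2 * (analyticOrderNatAt f w : ℂ) * w⁻¹ ^ 4 *
      (w⁻¹ ^ 2 / L) ^ n * (1 - w⁻¹ ^ 2 / L) ^ k) =
      ((1 / 2 * (analyticOrderNatAt f w : ℝ) * w.re⁻¹ ^ 4 *
      (w.re⁻¹ ^ 2 / L) ^ n * (1 - w.re⁻¹ ^ 2 / L) ^ k : ℝ) : ℂ) := by
    push_cast
    rw [← hwr]
  rw [h4]
  exact_mod_cast h3

/-- An even continuous function with zeros, all of which are in a horizontal strip and off the
imaginary axis, has a zero with the smallest positive real part. -/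
theorem exists_isLeast_re {f : ℂ → ℂ} (hf : Continuous f) (heven : ∀ s, f (-s) = f s) {b : ℝ}
    (him : ∀ z, f z = 0 → |z.im| ≤ b) (hre : ∀ z, f z = 0 → z.re ≠ 0) (hex : ∃ z, f z = 0) :
    ∃ s₁ : ℝ, IsLeast {x : ℝ | 0 < x ∧ ∃ z : ℂ, f z = 0 ∧ z.re = x} s₁ := by
  obtain ⟨z₀, hz₀, hpos⟩ : ∃ z, f z = 0 ∧ 0 < z.re := by
    obtain ⟨z, hz⟩ := hex
    rcases lt_or_gt_of_ne (hre z hz) with h | h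
    · exact ⟨-z, by rw [heven, hz], by simpa using h⟩
    · exact ⟨z, hz, h⟩
  set K : Set ℂ := f ⁻¹' {0} ∩ (Icc 0 z₀.re ×ℂ Icc (-b) b) with hK
  have hKc : IsCompact K :=
    (isCompact_Icc.reProdIm isCompact_Icc).inter_left (isClosed_singleton.preimage hf)
  have hmem : ∀ z, f z = 0 → 0 ≤ z.re → z.re ≤ z₀.re → z ∈ K := fun z h1 h2 h3 =>
    ⟨h1, ⟨h2, h3⟩, abs_le.1 (him z h1)⟩
  obtain ⟨z₁, hz₁, hmin⟩ := hKc.exists_isMinOn ⟨z₀, hmem z₀ hz₀ hpos.le le_rfl⟩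
    Complex.continuous_re.continuousOn
  have h1 : f z₁ = 0 := hz₁.1
  have h2 : 0 ≤ z₁.re ∧ z₁.re ≤ z₀.re := hz₁.2.1
  refine ⟨z₁.re, ⟨lt_of_le_of_ne h2.1 (hre z₁ h1).symm, z₁, h1, rfl⟩, ?_⟩
  rintro x ⟨hx, z, hz, rfl⟩
  rcases le_total z.re z₀.re with h | h
  · exact hmin (hmem z hz hx.le h)
  · exact h2.2.trans h

end EntireFunction

namespace DirichletCharacter

variable {q : ℕ} [NeZero q]

theorem fFun_eq_zero_iff (hq : 1 < q) {χ : DirichletCharacter ℂ q} (hχ : χ.IsPrimitive) {s : ℂ}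
    (hs : s ≠ 0) : χ.fFun s = 0 ↔
      χ.xi (1 / 2 + Complex.I * s) = 0 ∨ χ.xi (1 / 2 + Complex.I * -s) = 0 := by
  rw [fFun_eq hq hχ, mul_eq_zero, xiQuot, xiQuot, if_neg hs, if_neg hs,
    div_eq_zero_iff, div_eq_zero_iff, xi_inv_eq_zero_iff hq hχ]
  simp [hs]

/-- Away from `0` the zeros of `f` are those of `s ↦ ξ(1/2 + is, χ)` together with their negatives.
A zero of `ξ` at `s = 0` is divided out of `f`, but it is real. -/
theorem GRH_iff (hq : 1 < q) {χ : DirichletCharacter ℂ q} (hχ : χ.IsPrimitive) :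
    χ.GRH ↔ ∀ s, χ.fFun s = 0 → s.im = 0 := by
  have h0 : χ.fFun 0 ≠ 0 := by
    rw [fFun_zero hq hχ]
    exact bCoeff_zero_ne_zero hq hχ
  constructor
  · intro h s hs
    have hs0 : s ≠ 0 := by
      rintro rfl
      exact h0 hs
    rcases (fFun_eq_zero_iff hq hχ hs0).1 hs with h1 | h1
    · exact h s h1
    · simpa using h (-s) h1
  · intro h s hs
    by_cases hs0 : s = 0
    · simp [hs0]
    · exact h s ((fFun_eq_zero_iff hq hχ hs0).2 (Or.inl hs))

theorem abs_im_le_of_fFun_eq_zero (hq : 1 < q) {χ : DirichletCharacter ℂ q} (hχ : χ.IsPrimitive)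
    {s : ℂ} (hs : χ.fFun s = 0) : |s.im| ≤ 1 / 2 := by
  by_cases hs0 : s = 0
  · simp [hs0]
  · rcases (fFun_eq_zero_iff hq hχ hs0).1 hs with h1 | h1
    · exact abs_im_le_of_xi_eq_zero hq hχ h1
    · simpa using abs_im_le_of_xi_eq_zero hq hχ h1

/-- Outside the unit disc, division by `s^(2μ)` only decreases the product of the two `ξ` functions.
Inside, continuity suffices. -/
theorem subGaussian_fFun (hq : 1 < q) {χ : DirichletCharacter ℂ q} (hχ : χ.IsPrimitive) :
    EntireFunction.SubGaussian χ.fFun := by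
  intro ε hε
  have hχ1 := ne_one_of_isPrimitive hq hχ
  obtain ⟨C₁, hC₁, h₁⟩ := exists_norm_xi_le hq hχ1 (half_pos hε)
  obtain ⟨C₂, hC₂, h₂⟩ := exists_norm_xi_le hq (inv_ne_one hχ1) (half_pos hε)
  obtain ⟨C₃, h₃⟩ := (isCompact_closedBall (0 : ℂ) 1).exists_bound_of_continuousOn
    (differentiable_fFun hq hχ).continuous.continuousOn
  refine ⟨max C₃ (C₁ * C₂), fun z => ?_⟩
  by_cases hz : ‖z‖ ≤ 1
  · calc ‖χ.fFun z‖ ≤ C₃ := h₃ z (by simpa using hz)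
      _ ≤ max C₃ (C₁ * C₂) := le_max_left _ _
      _ ≤ max C₃ (C₁ * C₂) * Real.exp (ε * ‖z‖ ^ 2) :=
        le_mul_of_one_le_right (le_max_of_le_right (mul_nonneg hC₁ hC₂))
          (Real.one_le_exp (by positivity))
  · have hz1 : 1 < ‖z‖ := not_le.1 hz
    have hz0 : z ≠ 0 := by
      rintro rfl
      simp at hz
    have hq : ∀ (ψ : DirichletCharacter ℂ q), ‖ψ.xiQuot z‖ ≤ ‖ψ.xi (1 / 2 + Complex.I * z)‖ :=
      fun ψ => by
        rw [xiQuot, if_neg hz0, norm_div, norm_pow]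
        exact div_le_self (norm_nonneg _) (one_le_pow₀ hz1.le)
    rw [fFun_eq (by assumption) hχ, norm_mul]
    calc ‖χ.xiQuot z‖ * ‖χ⁻¹.xiQuot z‖
        ≤ (C₁ * Real.exp (ε / 2 * ‖z‖ ^ 2)) * (C₂ * Real.exp (ε / 2 * ‖z‖ ^ 2)) := by
          gcongr
          · exact (hq χ).trans (h₁ z)
          · exact (hq χ⁻¹).trans (h₂ z)
      _ = C₁ * C₂ * Real.exp (ε * ‖z‖ ^ 2) := by
          rw [mul_mul_mul_comm, ← Real.exp_add]
          ring_nf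
      _ ≤ max C₃ (C₁ * C₂) * Real.exp (ε * ‖z‖ ^ 2) := by
          gcongr
          exact le_max_right _ _

/-- On the imaginary axis `f(iy)/b₀ = ∑ (b_n/b₀) y^(2n)`, a series of nonnegative terms starting
with `1`. -/
theorem re_ne_zero_of_fFun_eq_zero (hq : 1 < q) {χ : DirichletCharacter ℂ q} (hχ : χ.IsPrimitive)
    (hb : ∀ n : ℕ, 1 ≤ n → 0 < χ.bCoeff n / χ.bCoeff 0) {s : ℂ} (hs : χ.fFun s = 0) :
    s.re ≠ 0 := by
  intro hre
  have h0 := bCoeff_zero_ne_zero hq hχ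
  have h1 := (hasSum_fFun hq hχ s).div_const (χ.bCoeff 0)
  have hs2 : s ^ 2 = -((s.im ^ 2 : ℝ) : ℂ) := by
    have : s = s.im * Complex.I := by
      conv_lhs => rw [← Complex.re_add_im s, hre]
      simp
    rw [this, mul_pow, Complex.I_sq]
    simp
  have h2 : HasSum (fun n => χ.bCoeff n / χ.bCoeff 0 * ((s.im ^ 2 : ℝ) : ℂ) ^ n) 0 := by
    rw [hs, zero_div] at h1
    refine h1.congr_fun fun n => ?_
    rw [pow_mul, hs2, neg_pow]
    have : ((-1 : ℂ)) ^ n * (-1) ^ n = 1 := by rw [← mul_pow]; simp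
    linear_combination (-(χ.bCoeff n / χ.bCoeff 0 * ((s.im ^ 2 : ℝ) : ℂ) ^ n)) * this
  have h3 := le_hasSum h2 0 fun n hn => mul_nonneg (hb n (Nat.one_le_iff_ne_zero.2 hn)).le
    (pow_nonneg (by exact_mod_cast sq_nonneg s.im) n)
  rw [div_self h0, pow_zero, one_mul] at h3
  exact (zero_lt_one' ℂ).not_ge h3

/-- Without zeros the growth bound forces `(f'/f)'(0) = 0`, but this derivative is `-2 b₁/b₀`. -/
theorem exists_fFun_eq_zero (hq : 1 < q) {χ : DirichletCharacter ℂ q} (hχ : χ.IsPrimitive)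
    (hb : χ.bCoeff 1 ≠ 0) : ∃ s, χ.fFun s = 0 := by
  by_contra! h
  have h1 := EntireFunction.SubGaussian.iteratedDeriv_logDeriv_eq_zero (subGaussian_fFun hq hχ) (differentiable_fFun hq hχ) h
  have h2 : logDeriv χ.fFun = fun s => deriv χ.fFun s / χ.fFun s := funext fun s => logDeriv_apply _ s
  rw [h2, iteratedDeriv_one_logDeriv_fFun hq hχ] at h1
  have h0 := bCoeff_zero_ne_zero hq hχ
  exact mul_ne_zero (by norm_num) (div_ne_zero hb h0) h1

theorem GRH_iff_moments (hq : 1 < q) {χ : DirichletCharacter ℂ q} (hχ : χ.IsPrimitive) {s₁ : ℝ}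
    (hre : ∀ s, χ.fFun s = 0 → s.re ≠ 0)
    (hs₁ : IsLeast {x : ℝ | 0 < x ∧ ∃ z : ℂ, χ.fFun z = 0 ∧ z.re = x} s₁) :
    χ.GRH ↔ ∃ L : ℝ, (s₁ ^ 2)⁻¹ < L ∧ ∀ n k : ℕ,
      0 ≤ ∑ j ∈ Finset.range (k + 1),
        (-1) ^ j * (k.choose j : ℂ) * (χ.moment (n + j) / (L : ℂ) ^ (n + j)) := by
  have h0 : χ.fFun 0 ≠ 0 := by
    rw [fFun_zero hq hχ]
    exact bCoeff_zero_ne_zero hq hχ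
  have hpos : 0 < s₁ := hs₁.1.1
  have hlog : logDeriv χ.fFun = fun s => deriv χ.fFun s / χ.fFun s :=
    funext fun s => logDeriv_apply _ s
  rw [GRH_iff hq hχ]
  constructor
  · intro hreal
    -- Any `L > s₁⁻²` would do: all zeros satisfy `|Re z| ≥ s₁`, hence `L (Re z)² ≥ 1`.
    refine ⟨(s₁ ^ 2)⁻¹ + 1, lt_add_one _, fun n k => ?_⟩
    have h := EntireFunction.moments_nonneg (subGaussian_fFun hq hχ) (differentiable_fFun hq hχ) h0
      hreal (L := (s₁ ^ 2)⁻¹ + 1) (by positivity) (fun z hz => ?_) n k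
    · refine h.trans_eq (Finset.sum_congr rfl fun j _ => ?_)
      rw [hlog, iteratedDeriv_logDeriv_fFun]
      ring
    · have h1 : s₁ ^ 2 ≤ z.re ^ 2 := by
        rw [sq_le_sq, abs_of_pos hpos]
        rcases lt_or_gt_of_ne (hre z hz) with h | h
        · rw [abs_of_neg h]
          exact hs₁.2 ⟨by linarith, -z, by rw [fFun_neg hq hχ, hz], by simp⟩
        · rw [abs_of_pos h]
          exact hs₁.2 ⟨h, z, hz, rfl⟩
      calc (1 : ℝ) = (s₁ ^ 2)⁻¹ * s₁ ^ 2 := by field_simp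
        _ ≤ ((s₁ ^ 2)⁻¹ + 1) * z.re ^ 2 := by gcongr; linarith
  · rintro ⟨L, hL, hm⟩ s hs
    have hL0 : 0 < L := lt_trans (by positivity) hL
    -- The case `k = 0` of the inequalities contains the reality of each moment, so the real moment
    -- problem applies.
    have hc : ∀ n, (((χ.moment n / (L : ℂ) ^ n).re : ℝ) : ℂ) = χ.moment n / (L : ℂ) ^ n := by
      intro n
      have := hm n 0
      simp only [zero_add, Finset.sum_range_one, pow_zero, Nat.choose_self, Nat.cast_one, one_mul,
        add_zero] at this
      exact Complex.ext rfl (by simpa using (Complex.nonneg_iff.1 this).2)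
    refine EntireFunction.im_eq_zero_of_moments (differentiable_fFun hq hχ) h0 (fFun_neg hq hχ) hL0
      (c := fun n => (χ.moment n / (L : ℂ) ^ n).re) (fun n k => ?_) (fun n => ?_) hs
    · refine Complex.zero_le_real.1 ((hm n k).trans_eq ?_)
      push_cast
      exact Finset.sum_congr rfl fun j _ => by rw [hc]
    · have : (L : ℂ) ≠ 0 := by exact_mod_cast hL0.ne'
      rw [iteratedDeriv_logDeriv_fFun, hc]
      field_simp

end DirichletCharacter

end

theorem mainTheorem5 (q : ℕ) [NeZero q] (hq : 1 < q) (χ : DirichletCharacter ℂ q)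
    (hχ : χ.IsPrimitive) :
    -- the power series of `f`, with nonzero constant term
    (χ.bCoeff 0 ≠ 0 ∧
      ∀ s : ℂ, HasSum (fun n : ℕ => (-1) ^ n * χ.bCoeff n * s ^ (2 * n)) (χ.fFun s)) ∧
    -- the determinant formula
    (∀ n : ℕ, χ.moment n = (-1) ^ n * (χ.momentMatrix n).det) ∧
    -- the recursion
    (∀ n : ℕ, (-1) ^ n * χ.moment n =
      χ.bCoeff 1 * χ.bCoeff (n + 1) / χ.bCoeff 0 ^ 2 - (n + 2) * χ.bCoeff (n + 2) / χ.bCoeff 0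
        - ∑ k ∈ Finset.range n, (-1) ^ k * χ.moment k * χ.bCoeff (n - k) / χ.bCoeff 0) ∧
    -- the quotients `b_n / b_0`
    (∀ n : ℕ, χ.bCoeff n / χ.bCoeff 0 = ∑ j ∈ Finset.range (2 * n + 1),
      (-1) ^ j * (χ.aCoeff (j + χ.mu) / χ.aCoeff χ.mu) *
        (χ.aCoeff (2 * n - j + χ.mu) / χ.aCoeff χ.mu)) ∧
    -- the criterion; `0 < z` and `0 ≤ z` for complex `z` include that `z` is real
    ((∀ n : ℕ, 1 ≤ n → 0 < χ.bCoeff n / χ.bCoeff 0) →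
      ∃ s₁ : ℝ, IsLeast {x : ℝ | 0 < x ∧ ∃ z : ℂ, χ.fFun z = 0 ∧ z.re = x} s₁ ∧
        (χ.GRH ↔ ∃ L : ℝ, (s₁ ^ 2)⁻¹ < L ∧ ∀ n k : ℕ,
          0 ≤ ∑ j ∈ Finset.range (k + 1),
            (-1) ^ j * (k.choose j : ℂ) * (χ.moment (n + j) / (L : ℂ) ^ (n + j)))) := by
  refine ⟨⟨DirichletCharacter.bCoeff_zero_ne_zero hq hχ, DirichletCharacter.hasSum_fFun hq hχ⟩,
    DirichletCharacter.moment_eq_det hq hχ,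
    DirichletCharacter.neg_one_pow_mul_moment hq hχ,
    DirichletCharacter.bCoeff_div_bCoeff_zero hq hχ, fun hb => ?_⟩
  have hre : ∀ s, χ.fFun s = 0 → s.re ≠ 0 := fun s =>
    DirichletCharacter.re_ne_zero_of_fFun_eq_zero hq hχ hb
  have hb1 : χ.bCoeff 1 ≠ 0 := by
    intro h
    have := hb 1 le_rfl
    simp [h] at this
  obtain ⟨s₁, hs₁⟩ := EntireFunction.exists_isLeast_re
    (DirichletCharacter.differentiable_fFun hq hχ).continuous
    (DirichletCharacter.fFun_neg hq hχ)
    (fun z => DirichletCharacter.abs_im_le_of_fFun_eq_zero hq hχ) hre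
    (DirichletCharacter.exists_fFun_eq_zero hq hχ hb1)
  exact ⟨s₁, hs₁, DirichletCharacter.GRH_iff_moments hq hχ hre hs₁⟩
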